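/- Let $\Gamma$ be a finite plane graph: its vertices are finitely many distinct points of the plane, its edges are polygonal arcs joining vertices (a loop being a simple closed polygon through its vertex), and the interior of each edge contains no vertex and no point of another edge. Loops, multiple edges, isolated vertices and several connected components are allowed. The medial graph $M(\Gamma)$ is obtained from the boundary of a regular neighbourhood of $\Gamma$ by pinching each edge to create a vertex of degree $4$; thus its vertices are the edges of $\Gamma$, its edges are the corners of $\Gamma$ (the pieces of the boundary between two consecutive edge ends around a vertex), and each isolated vertex of $\Gamma$ contributes a closed curve without vertices. Let $L$ be a link given by a diagram that is obtained from $M(\Gamma)$ by resolving each vertex, in either of the two ways, as a crossing, so that one of the two strands through the vertex (each joining opposite sides) passes over the other. Let $Q_2(\Gamma)$ be the mod-$2$ Laplacian matrix of $\Gamma$: its rows and columns are indexed by the vertices, the diagonal entry at a vertex is its degree (a loop counts twice), the entry at two different vertices is the number of edges between them, and all entries are taken modulo $2$. Then the number $\mu(L)$ of components of $L$ equals the nullity of $Q_2(\Gamma)$ over $\mathbb{Z}/2$, that is, the dimension of its null space. -/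

import Mathlib

noncomputable section

/-- A polygonal path in the plane `ℂ`, given by its successive corners
`corner 0, corner 1, …, corner (bends + 1)`; it has `bends + 1` straight segments. -/
structure PolygonalPath where
  /-- The number of corners strictly between the two ends. -/
  bends : ℕ
  /-- The corners, including the two ends. -/
  corner : Fin (bends + 2) → ℂ

namespace PolygonalPath

/-- The point at time `t` of the `i`-th segment (times `0 ≤ t ≤ 1` run through the segment). -/
def point (p : PolygonalPath) (i : Fin (p.bends + 1)) (t : ℝ) : ℂ :=
  AffineMap.lineMap (p.corner i.castSucc) (p.corner i.succ) t

/-- The same path, traversed backwards. -/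
def reverse (p : PolygonalPath) : PolygonalPath where
  bends := p.bends
  corner j := p.corner j.rev

/-- The direction in which the path leaves its starting point. -/
def dir (p : PolygonalPath) : ℂ := p.corner 1 - p.corner 0

end PolygonalPath

/-- A plane graph with vertices `V` and edges `E` (loops, multiple edges, isolated vertices and
several connected components are allowed): the vertices are distinct points of the plane, every
edge is a polygonal arc between its two end vertices (a simple closed polygon through its vertex,
for a loop), and the interior of an edge contains no vertex and no point of another edge.
The order of the two ends of an edge is a labelling without meaning. -/
structure PlaneGraph (V E : Type*) where
  /-- The position of a vertex. -/
  pos : V → ℂ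
  pos_injective : Function.Injective pos
  /-- The first end of an edge. -/
  tail : E → V
  /-- The second end of an edge. -/
  head : E → V
  /-- The drawing of an edge. -/
  path : E → PolygonalPath
  path_start : ∀ e, (path e).corner 0 = pos (tail e)
  path_end : ∀ e, (path e).corner (Fin.last _) = pos (head e)
  /-- Each interior point of an edge is met at one place of one edge only. Interior points are
  listed as the points at times `0 ≤ t < 1` of the segments, without the start of the first. -/
  interior_injOn : Set.InjOn
    (fun x : (Σ e : E, Fin ((path e).bends + 1) × ℝ) => (path x.1).point x.2.1 x.2.2)
    {x | x.2.2 ∈ Set.Ico (0 : ℝ) 1 ∧ ¬ (x.2.1 = 0 ∧ x.2.2 = 0)}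
  /-- No interior point of an edge is a vertex. -/
  interior_ne_pos : ∀ (e : E) (i : Fin ((path e).bends + 1)) (t : ℝ), t ∈ Set.Ico (0 : ℝ) 1 →
    ¬ (i = 0 ∧ t = 0) → ∀ v, (path e).point i t ≠ pos v

/-- The angle in `(0, 2π]` by which one has to turn counterclockwise from the direction of `z`
to the direction of `w`; a full turn if the directions agree. -/
def ccwAngle (z w : ℂ) : ℝ := toIocMod Real.two_pi_pos 0 (w.arg - z.arg)

theorem ccwAngle_self (z : ℂ) : ccwAngle z z = 2 * Real.pi := by
  unfold ccwAngle
  rw [toIocMod_eq_iff]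
  exact ⟨⟨by simpa using Real.two_pi_pos, by simp⟩, -1, by simp⟩

theorem ccwAngle_eq (z w : ℂ) :
    ccwAngle z w = if z.arg < w.arg then w.arg - z.arg else w.arg - z.arg + 2 * Real.pi := by
  have h1 := Complex.neg_pi_lt_arg z
  have h2 := Complex.arg_le_pi z
  have h3 := Complex.neg_pi_lt_arg w
  have h4 := Complex.arg_le_pi w
  unfold ccwAngle
  rw [toIocMod_eq_iff]
  split_ifs with h
  · exact ⟨⟨by linarith, by linarith⟩, 0, by simp⟩
  · exact ⟨⟨by linarith, by linarith⟩, -1, by simp⟩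

namespace PlaneGraph

variable {V E : Type*}

/-- A half-edge: `(e, false)` is `e` as seen from its first end, `(e, true)` is `e` as seen from
its second end. -/
abbrev Dart (_Γ : PlaneGraph V E) : Type _ := E × Bool

variable (Γ : PlaneGraph V E)

/-- The vertex at which a half-edge starts. -/
def source (d : Γ.Dart) : V := if d.2 then Γ.head d.1 else Γ.tail d.1

/-- The drawing of a half-edge, starting at its source. -/
def dartPath (d : Γ.Dart) : PolygonalPath := if d.2 then (Γ.path d.1).reverse else Γ.path d.1

/-- The direction in which a half-edge leaves its source. -/
def dir (d : Γ.Dart) : ℂ := (Γ.dartPath d).dir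

theorem corner_ne (e : E) (i : Fin ((Γ.path e).bends + 1)) :
    (Γ.path e).corner i.castSucc ≠ (Γ.path e).corner i.succ := by
  intro h
  have : (⟨e, i, 1/2⟩ : Σ e : E, Fin ((Γ.path e).bends + 1) × ℝ) = ⟨e, i, 1/3⟩ :=
    Γ.interior_injOn (by norm_num) (by norm_num) (by simp [PolygonalPath.point, h])
  norm_num at this

theorem dir_false (e : E) : Γ.dir (e, false) =
    (Γ.path e).corner (Fin.succ 0) - (Γ.path e).corner (Fin.castSucc 0) := rfl

theorem dir_true (e : E) : Γ.dir (e, true) =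
    (Γ.path e).corner (Fin.castSucc (Fin.last _)) - (Γ.path e).corner (Fin.succ (Fin.last _)) := by
  have h : ∀ n : ℕ, Fin.rev (1 : Fin (n + 2)) = Fin.castSucc (Fin.last n) := by
    intro n; ext; simp [Fin.val_rev]
  have h' : ∀ n : ℕ, Fin.rev (0 : Fin (n + 2)) = Fin.succ (Fin.last n) := by
    intro n; ext; simp
  rw [← h, ← h']
  rfl

theorem dir_ne_zero (d : Γ.Dart) : Γ.dir d ≠ 0 := by
  obtain ⟨e, b⟩ := d
  cases b
  · rw [dir_false]; exact sub_ne_zero.2 (Γ.corner_ne e 0).symm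
  · rw [dir_true]; exact sub_ne_zero.2 (Γ.corner_ne e (Fin.last _))

/-- The first segment of a half-edge, as a segment of its edge. -/
theorem exists_point (d : Γ.Dart) (t : ℝ) :
    (Γ.path d.1).point (if d.2 then Fin.last _ else 0) (if d.2 then 1 - t else t) =
      Γ.pos (Γ.source d) + t * Γ.dir d := by
  obtain ⟨e, b⟩ := d
  cases b
  · have := Γ.path_start e
    simp only [dir_false, source, PolygonalPath.point, AffineMap.lineMap_apply]
    simp [← this]
    ring
  · have := Γ.path_end e
    simp only [dir_true, source, PolygonalPath.point, AffineMap.lineMap_apply]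
    simp [← this]
    ring

/-- Distinct half-edges at a vertex leave it in distinct directions. -/
theorem eq_of_arg_eq {d d' : Γ.Dart} (hs : Γ.source d = Γ.source d')
    (ha : (Γ.dir d).arg = (Γ.dir d').arg) : d = d' := by
  have hz := Γ.dir_ne_zero d
  have hz' := Γ.dir_ne_zero d'
  rw [Complex.arg_eq_arg_iff hz hz'] at ha
  set r : ℝ := ‖Γ.dir d'‖ / ‖Γ.dir d‖ with hr
  have hr0 : 0 < r := div_pos (norm_pos_iff.2 hz') (norm_pos_iff.2 hz)
  have ha' : (r : ℂ) * Γ.dir d = Γ.dir d' := by rw [← ha, hr]; push_cast; rfl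
  -- a time `t` on `d'` corresponds to the time `t * r` on `d`
  set t : ℝ := 1 / (2 * (1 + r)) with ht
  have ht0 : 0 < t := by positivity
  have ht1 : t < 1 := by rw [ht, div_lt_one (by positivity)]; linarith
  have htr : t * r < 1 := by
    rw [ht, div_mul_eq_mul_div, div_lt_one (by positivity)]; linarith
  have htr0 : 0 < t * r := by positivity
  have e1 := Γ.exists_point d (t * r)
  have e2 := Γ.exists_point d' t
  have heq : Γ.pos (Γ.source d) + ((t * r : ℝ) : ℂ) * Γ.dir d
      = Γ.pos (Γ.source d') + (t : ℂ) * Γ.dir d' := by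
    rw [hs, ← ha']; push_cast; ring
  rw [← e1, ← e2] at heq
  have key : (⟨d.1, if d.2 then Fin.last _ else 0, if d.2 then 1 - t * r else t * r⟩ :
      Σ e : E, Fin ((Γ.path e).bends + 1) × ℝ) =
      ⟨d'.1, if d'.2 then Fin.last _ else 0, if d'.2 then 1 - t else t⟩ := by
    refine Γ.interior_injOn ⟨?_, fun h => ?_⟩ ⟨?_, fun h => ?_⟩ heq
    · dsimp only; split_ifs <;> constructor <;> linarith
    · have := h.2; dsimp only at this; split_ifs at this <;> linarith
    · dsimp only; split_ifs <;> constructor <;> linarith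
    · have := h.2; dsimp only at this; split_ifs at this <;> linarith
  -- a single segment cannot be a loop
  have loop : ∀ e : E, Γ.source (e, false) = Γ.source (e, true) →
      Fin.last ((Γ.path e).bends) = 0 → False := by
    intro e h1 h2
    have h3 := Γ.corner_ne e 0
    apply h3
    have h4 := Γ.path_start e
    have h5 := Γ.path_end e
    have h6 : Γ.tail e = Γ.head e := by simpa [source] using h1
    rw [h6, ← h5, ← Fin.succ_last, h2] at h4
    exact h4
  obtain ⟨e, b⟩ := d
  obtain ⟨e', b'⟩ := d'
  have he : e = e' := congrArg Sigma.fst key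
  subst he
  simp only [Sigma.mk.injEq, heq_eq_eq, true_and, Prod.mk.injEq] at key
  cases b <;> cases b'
  · rfl
  · exact (loop e hs (by simpa using key.1.symm)).elim
  · exact (loop e hs.symm (by simpa using key.1)).elim
  · rfl

variable [Finite E]

theorem exists_next (d : Γ.Dart) : ∃ d' : Γ.Dart, Γ.source d' = Γ.source d ∧
    ∀ d'' : Γ.Dart, Γ.source d'' = Γ.source d →
      ccwAngle (Γ.dir d) (Γ.dir d') ≤ ccwAngle (Γ.dir d) (Γ.dir d'') := by
  obtain ⟨d', h, h'⟩ := Set.exists_min_image {d' : Γ.Dart | Γ.source d' = Γ.source d}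
    (fun d' => ccwAngle (Γ.dir d) (Γ.dir d')) (Set.toFinite _) ⟨d, rfl⟩
  exact ⟨d', h, h'⟩

/-- The half-edge that follows `d` in the counterclockwise order around the source of `d`
(`d` itself, if no other half-edge starts there). -/
def next (d : Γ.Dart) : Γ.Dart := (Γ.exists_next d).choose

theorem source_next (d : Γ.Dart) : Γ.source (Γ.next d) = Γ.source d :=
  (Γ.exists_next d).choose_spec.1

theorem ccwAngle_next_le (d d' : Γ.Dart) (h : Γ.source d' = Γ.source d) :
    ccwAngle (Γ.dir d) (Γ.dir (Γ.next d)) ≤ ccwAngle (Γ.dir d) (Γ.dir d') :=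
  (Γ.exists_next d).choose_spec.2 d' h

theorem next_injective : Function.Injective Γ.next := by
  intro d₁ d₂ h
  have hs : Γ.source d₁ = Γ.source d₂ := by rw [← Γ.source_next d₁, h, Γ.source_next]
  apply Γ.eq_of_arg_eq hs
  have h1 := Γ.ccwAngle_next_le d₁ d₂ hs.symm
  have h2 := Γ.ccwAngle_next_le d₂ d₁ hs
  rw [h] at h1
  have hp := Real.pi_pos
  have b1 := Complex.neg_pi_lt_arg (Γ.dir d₁)
  have b2 := Complex.arg_le_pi (Γ.dir d₁)
  have b3 := Complex.neg_pi_lt_arg (Γ.dir d₂)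
  have b4 := Complex.arg_le_pi (Γ.dir d₂)
  have b5 := Complex.neg_pi_lt_arg (Γ.dir (Γ.next d₂))
  have b6 := Complex.arg_le_pi (Γ.dir (Γ.next d₂))
  simp only [ccwAngle_eq] at h1 h2
  by_contra hne
  rcases lt_or_gt_of_ne hne with hlt | hlt
  · split_ifs at h1 h2 <;> linarith
  · split_ifs at h1 h2 <;> linarith

/-- The rotation of a plane graph: it turns each half-edge counterclockwise to the next one. -/
def rot : Equiv.Perm Γ.Dart :=
  Equiv.ofBijective Γ.next (Finite.injective_iff_bijective.1 Γ.next_injective)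

end PlaneGraph

/-- A diagram of closed curves that cross each other at 4-valent vertices, as a combinatorial
object: `X` is the set of crossings, `A` the set of arcs between crossings, and `C` the set of
closed curves without any crossing. The four places at a crossing are numbered
counterclockwise; each of the two ends of each arc sits at one of these places, and each place
is taken by exactly one end. -/
structure FlatDiagram (X A C : Type*) where
  /-- The place of each end of each arc. -/
  place : A × Bool ≃ X × Fin 4

/-- A link diagram: at each crossing one of the two strands (one joins the opposite places `0`
and `2`, the other the opposite places `1` and `3`) is chosen to pass over the other. -/
structure LinkDiagram (X A C : Type*) extends FlatDiagram X A C where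
  /-- Whether the strand through the places `1` and `3` is the upper one. -/
  oddOver : X → Bool

namespace LinkDiagram

variable {X A C : Type*} (L : LinkDiagram X A C)

/-- Whether the strand through the place `k` of the crossing `x` is the upper strand there. -/
def isUpper (x : X) (k : Fin 4) : Bool := decide (k.val % 2 = 1) == L.oddOver x

/-- Two arcs are joined if they have ends at the same crossing and at the same level, so that
the link runs from the one to the other there. -/
def Joined (a b : A) : Prop :=
  ∃ s t : Bool, (L.place (a, s)).1 = (L.place (b, t)).1 ∧
    L.isUpper (L.place (a, s)).1 (L.place (a, s)).2 =
      L.isUpper (L.place (b, t)).1 (L.place (b, t)).2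

/-- The components of the link: the classes of arcs under the equivalence relation generated by
`Joined`, and the closed curves without crossings. -/
def Component : Type _ := Quot L.Joined ⊕ C

/-- The number of components of the link. -/
def numComponents : ℕ := Nat.card L.Component

end LinkDiagram

/-- Resolve every vertex of a flat diagram as a crossing, in one of the two ways. -/
def FlatDiagram.resolve {X A C : Type*} (F : FlatDiagram X A C) (r : X → Bool) :
    LinkDiagram X A C where
  toFlatDiagram := F
  oddOver := r

namespace PlaneGraph

variable {V E : Type*} (Γ : PlaneGraph V E)

/-- The vertices without any edge. -/
abbrev Isolated : Type _ := {v : V // ∀ d : Γ.Dart, Γ.source d ≠ v}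

/-- The four quarters of a regular neighbourhood's boundary along an edge `e`, in
counterclockwise order around the middle of `e`: to the left (`true`) and to the right (`false`)
of the half-edge `(e, false)`, then to the left and to the right of `(e, true)`. -/
def quarter : Bool × Bool ≃ Fin 4 where
  toFun
    | (false, true) => 0
    | (false, false) => 1
    | (true, true) => 2
    | (true, false) => 3
  invFun
    | 0 => (false, true)
    | 1 => (false, false)
    | 2 => (true, true)
    | 3 => (true, false)
  left_inv := by decide
  right_inv := by decide

variable [Finite E]

/-- The ends of the corners of `Γ`, as sides of half-edges. The corner at a half-edge `d` lies
between `d` and the next half-edge `d'` counterclockwise around the same vertex. It runs from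
the left side (`true`) of `d` to the right side (`false`) of `d'`. -/
def cornerEnd : Γ.Dart × Bool ≃ Γ.Dart × Bool where
  toFun x := if x.2 then (Γ.rot x.1, false) else (x.1, true)
  invFun y := if y.2 then (y.1, false) else (Γ.rot.symm y.1, true)
  left_inv := by rintro ⟨d, _ | _⟩ <;> simp
  right_inv := by rintro ⟨d, _ | _⟩ <;> simp

/-- The medial graph: the boundary of a regular neighbourhood of `Γ`, pinched at each edge.
Its vertices are the edges of `Γ`. Its edges are the corners of `Γ`, that is, the pieces of the
boundary between two consecutive half-edges at a vertex. An isolated vertex of `Γ` contributes a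
closed curve without vertices. -/
def medial : FlatDiagram E Γ.Dart Γ.Isolated where
  place := Γ.cornerEnd.trans ((Equiv.prodAssoc E Bool Bool).trans
    ((Equiv.refl E).prodCongr quarter))

end PlaneGraph

namespace PlaneGraph

variable {V E : Type*} [DecidableEq V] [Fintype E] (Γ : PlaneGraph V E)

/-- The degree of a vertex: the number of half-edges at it, so that a loop counts twice. -/
def degree (v : V) : ℕ := (Finset.univ.filter fun d : Γ.Dart => Γ.source d = v).card

/-- The number of edges between two vertices. -/
def numEdges (v w : V) : ℕ :=
  (Finset.univ.filter fun e : E =>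
    (Γ.tail e = v ∧ Γ.head e = w) ∨ (Γ.tail e = w ∧ Γ.head e = v)).card

/-- The mod-2 Laplacian matrix `Q₂(Γ)`. -/
def mod2Laplacian : Matrix V V (ZMod 2) :=
  Matrix.of fun v w => if v = w then (Γ.degree v : ZMod 2) else (Γ.numEdges v w : ZMod 2)

end PlaneGraph

end

/-!
The number of components of the link and the nullity of the Laplacian are compared through the
space `W` of mod-2 Dehn colourings (`PlaneGraph.dehnColorings`): colourings `f` of the vertices and
`g` of the faces of `Γ` by elements of `ZMod 2` such that the four colours around each edge have
sum `0`.

Giving each corner the sum of the colours of its vertex and its face, and each curve around an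
isolated vertex the colour of that vertex, maps `W` onto the functions on the components of the link
(`map_curveColoring`): the condition at an edge says that opposite corners get equal values.
Forgetting `g` maps `W` onto the kernel of the Laplacian (`map_fst_dehnColorings`), as `f` is in this
kernel exactly if the edges along which `f` changes form a mod-2 cycle. The kernels of both maps are
isomorphic to the space of functions `g` that are constant on the connected components of `Γ`
(`map_snd_inf_ker`), and so the two images have the same dimension.

Both surjectivity statements need planarity, in the form that a mod-2 cycle `Z` in a plane graph
bounds: the faces can be coloured with two colours that differ exactly across the edges of `Z`
(`exists_coloring`). This is shown without the Jordan curve theorem. After cutting the edges into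
straight segments, let `R(p)` be the product over all segments `[a, b]` in `Z` of
`(a - p) * √((b - p) / (a - p))`, with the principal branch of the root. As
`(b - p) / (a - p)` is a negative real number only inside the segment, `R` is continuous off the
segments, and it changes its sign across each of them. Moreover, `R(p) ^ 2` is the product of
`(a - p) * (b - p)`, which is the square of a polynomial `H(p)` because each point is an end of an
even number of segments in `Z`. Hence `R / H` is a locally constant sign, and this is the colour.
Since the principal logarithm is continuous from above on the negative real axis, `R` restricted to
the closed left side of an oriented segment is continuous up to the segment, so that the colours on
the two sides can be read off at the points of the segment itself
(`SegmentDrawing.leftColor`), and compared along small arcs around a vertex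
(`SegmentDrawing.IsSqrt.leftColor_eq`).
-/

/-! ### A square root with a branch cut along a segment -/

noncomputable section

open Complex ComplexConjugate

/-- A square root of `(a - p) * (b - p)`, as a function of `p`. It is continuous off the segment
from `a` to `b`; on the interior of the segment, the principal branch of the logarithm makes it
the limit from the left of the direction from `a` to `b`. -/
def halfRoot (a b p : ℂ) : ℂ := (a - p) * exp (log ((b - p) / (a - p)) / 2)

/-- `p` lies in the closed half-plane to the left of the line from `a` to `b`, and is neither
`a` nor `b`. -/
def LeftOf (a b p : ℂ) : Prop := p ≠ a ∧ p ≠ b ∧ 0 ≤ ((b - p) / (a - p)).im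

theorem halfRoot_sq {a b p : ℂ} (ha : p ≠ a) (hb : p ≠ b) :
    halfRoot a b p ^ 2 = (a - p) * (b - p) := by
  have ha' : a - p ≠ 0 := sub_ne_zero.2 ha.symm
  have hb' : b - p ≠ 0 := sub_ne_zero.2 hb.symm
  rw [halfRoot, mul_pow, ← exp_nat_mul]
  rw [show ((2 : ℕ) : ℂ) * (log ((b - p) / (a - p)) / 2) = log ((b - p) / (a - p)) by
    push_cast; ring, exp_log (div_ne_zero hb' ha')]
  field_simp

/-- The quotient `(b - p) / (a - p)` is a non-positive real number only on the segment. -/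
theorem div_mem_slitPlane_of_notMem_segment {a b p : ℂ} (h : p ∉ segment ℝ a b) :
    (b - p) / (a - p) ∈ slitPlane := by
  rw [mem_slitPlane_iff_not_le_zero]
  intro hle
  apply h
  have ha : a - p ≠ 0 := fun h0 => h (by
    rw [← sub_eq_zero.1 h0]; exact left_mem_segment ℝ a b)
  rw [Complex.le_def] at hle
  set r : ℝ := -((b - p) / (a - p)).re with hr
  have hr0 : 0 ≤ r := by have := hle.1; simp only [zero_re] at this; linarith
  have hw : (b - p) / (a - p) = -(r : ℂ) := by
    apply Complex.ext
    · simp [hr]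
    · simpa using hle.2
  rw [div_eq_iff ha] at hw
  have h1 : (1 + r : ℂ) ≠ 0 := by
    have : (1 + r : ℝ) ≠ 0 := by positivity
    exact_mod_cast this
  refine ⟨r / (1 + r), 1 / (1 + r), by positivity, by positivity, by field_simp; ring, ?_⟩
  simp only [real_smul]
  push_cast
  field_simp
  linear_combination hw

theorem halfRoot_swap_of_notMem_segment {a b p : ℂ} (h : p ∉ segment ℝ a b) :
    halfRoot b a p = halfRoot a b p := by
  have ha : a - p ≠ 0 := fun h0 => h (by
    rw [← sub_eq_zero.1 h0]; exact left_mem_segment ℝ a b)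
  have hb : b - p ≠ 0 := fun h0 => h (by
    rw [← sub_eq_zero.1 h0]; exact right_mem_segment ℝ a b)
  have hs := div_mem_slitPlane_of_notMem_segment h
  have hlog : log ((a - p) / (b - p)) = -log ((b - p) / (a - p)) := by
    rw [← inv_div, log_inv _ (slitPlane_arg_ne_pi hs)]
  have hexp : exp (log ((b - p) / (a - p)) / 2) * exp (log ((b - p) / (a - p)) / 2)
      = (b - p) / (a - p) := by
    rw [← exp_add, add_halves, exp_log (div_ne_zero hb ha)]
  unfold halfRoot
  rw [hlog, neg_div, exp_neg]
  have h0 := exp_ne_zero (log ((b - p) / (a - p)) / 2)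
  field_simp
  rw [pow_two, hexp]
  field_simp

/-- The root `halfRoot a b` has opposite limits from the two sides of the segment. -/
theorem halfRoot_swap_of_mem_openSegment {a b p : ℂ} (hab : a ≠ b)
    (h : p ∈ openSegment ℝ a b) : halfRoot b a p = -halfRoot a b p := by
  obtain ⟨s, t, hs, ht, hst, rfl⟩ := h
  have hst' : (s : ℂ) + t = 1 := by exact_mod_cast hst
  have hs0 : (s : ℂ) ≠ 0 := by exact_mod_cast hs.ne'
  have ht0 : (t : ℂ) ≠ 0 := by exact_mod_cast ht.ne'
  have hba : b - a ≠ 0 := sub_ne_zero.2 hab.symm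
  simp only [real_smul]
  have ea : a - (s * a + t * b) = -t * (b - a) := by linear_combination (-a) * hst'
  have eb : b - (s * a + t * b) = s * (b - a) := by linear_combination (-b) * hst'
  have e1 : (b - (s * a + t * b)) / (a - (s * a + t * b)) = ((-(s / t) : ℝ) : ℂ) := by
    rw [ea, eb]; push_cast; field_simp
  have e2 : (a - (s * a + t * b)) / (b - (s * a + t * b)) = ((-(t / s) : ℝ) : ℂ) := by
    rw [ea, eb]; push_cast; field_simp
  have key : ∀ r : ℝ, 0 < r → exp (log ((-r : ℝ) : ℂ) / 2) = I * (Real.sqrt r : ℂ) := by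
    intro r hr
    have : log ((-r : ℝ) : ℂ) = Real.log r + Real.pi * I := by
      rw [log, norm_real, arg_ofReal_of_neg (by linarith)]
      simp [abs_of_pos hr]
    rw [this, add_div, exp_add, mul_comm]
    congr 1
    · rw [show (Real.pi : ℂ) * I / 2 = Real.pi / 2 * I by ring, exp_pi_div_two_mul_I]
    · rw [Real.sqrt_eq_rpow, Real.rpow_def_of_pos hr]
      push_cast
      congr 1
      ring
  unfold halfRoot
  rw [e1, e2, key _ (by positivity), key _ (by positivity), ea, eb, Real.sqrt_div hs.le,
    Real.sqrt_div ht.le]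
  have h1 : (Real.sqrt s : ℂ) ^ 2 = s := by exact_mod_cast Real.sq_sqrt hs.le
  have h2 : (Real.sqrt t : ℂ) ^ 2 = t := by exact_mod_cast Real.sq_sqrt ht.le
  have h3 : (Real.sqrt s : ℂ) ≠ 0 := by exact_mod_cast (Real.sqrt_pos.2 hs).ne'
  have h4 : (Real.sqrt t : ℂ) ≠ 0 := by exact_mod_cast (Real.sqrt_pos.2 ht).ne'
  push_cast
  field_simp
  rw [h1, h2]

theorem leftOf_of_mem_openSegment {a b p : ℂ} (hab : a ≠ b) (h : p ∈ openSegment ℝ a b) :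
    LeftOf a b p := by
  refine ⟨fun h' => hab ?_, fun h' => hab ?_, ?_⟩
  · subst h'; exact left_mem_openSegment_iff.1 h
  · subst h'; exact right_mem_openSegment_iff.1 h
  · obtain ⟨s, t, hs, ht, hst, rfl⟩ := h
    have hst' : (s : ℂ) + t = 1 := by exact_mod_cast hst
    have ht0 : (t : ℂ) ≠ 0 := by exact_mod_cast ht.ne'
    have hba : b - a ≠ 0 := sub_ne_zero.2 hab.symm
    simp only [real_smul]
    have ea : a - (s * a + t * b) = -t * (b - a) := by linear_combination (-a) * hst'
    have eb : b - (s * a + t * b) = s * (b - a) := by linear_combination (-b) * hst'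
    have e1 : (b - (s * a + t * b)) / (a - (s * a + t * b)) = ((-(s / t) : ℝ) : ℂ) := by
      rw [ea, eb]; push_cast; field_simp
    rw [e1, ofReal_im]

theorem leftOf_of_im_nonneg {a b p : ℂ} (ha : p ≠ a) (hb : p ≠ b)
    (h : 0 ≤ ((b - p) * conj (a - p)).im) : LeftOf a b p := by
  refine ⟨ha, hb, ?_⟩
  rw [div_eq_mul_inv, inv_def, ← mul_assoc, im_mul_ofReal]
  exact mul_nonneg h (inv_nonneg.2 (normSq_nonneg _))

/-- Along a curve that either avoids the segment or stays to the left of it, `halfRoot` is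
continuous. -/
theorem continuousOn_halfRoot_comp {a b : ℂ} {γ : ℝ → ℂ} {S : Set ℝ} (hγ : ContinuousOn γ S)
    (h : (∀ x ∈ S, γ x ∉ segment ℝ a b) ∨ ∀ x ∈ S, LeftOf a b (γ x)) :
    ContinuousOn (fun x => halfRoot a b (γ x)) S := by
  have ha : ∀ x ∈ S, a - γ x ≠ 0 := by
    intro x hx h0
    rcases h with h | h
    · exact h x hx (by rw [← sub_eq_zero.1 h0]; exact left_mem_segment ℝ a b)
    · exact (h x hx).1 (sub_eq_zero.1 h0).symm
  have hq : ContinuousOn (fun x => (b - γ x) / (a - γ x)) S :=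
    (continuousOn_const.sub hγ).div (continuousOn_const.sub hγ) ha
  have hlog : ContinuousOn (fun x => log ((b - γ x) / (a - γ x))) S := by
    rcases h with h | h
    · exact hq.clog fun x hx => div_mem_slitPlane_of_notMem_segment (h x hx)
    · intro x hx
      have hb : b - γ x ≠ 0 := fun h0 => (h x hx).2.1 (sub_eq_zero.1 h0).symm
      by_cases hs : (b - γ x) / (a - γ x) ∈ slitPlane
      · exact (hq x hx).clog hs
      · rw [mem_slitPlane_iff, not_or, not_lt, not_not] at hs
        have hre : ((b - γ x) / (a - γ x)).re < 0 := by
          refine lt_of_le_of_ne hs.1 fun h0 => div_ne_zero hb (ha x hx) ?_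
          exact Complex.ext h0 hs.2
        exact ContinuousWithinAt.comp (g := log) (t := {z : ℂ | 0 ≤ z.im})
          (continuousWithinAt_log_of_re_neg_of_im_zero hre hs.2) (hq x hx)
          fun y hy => (h y hy).2.2
  exact (continuousOn_const.sub hγ).mul (hlog.div_const 2).cexp

/-! ### Two-colouring the complement of an even family of segments -/

/-- A family of straight segments in the plane such that no interior point of one of them lies
on another one. The segments may share ends. -/
structure SegmentDrawing (J : Type*) where
  /-- The two ends of a segment. A segment seen from one of its ends is a pair in `J × Bool`. -/
  pt : J → Bool → ℂ
  pt_ne : ∀ j, pt j false ≠ pt j true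
  notMem_segment : ∀ j k x, j ≠ k → x ∈ openSegment ℝ (pt j false) (pt j true) →
    x ∉ segment ℝ (pt k false) (pt k true)

namespace SegmentDrawing

variable {J : Type*} (D : SegmentDrawing J)

/-- The segment, as a set of points. -/
def seg (j : J) : Set ℂ := segment ℝ (D.pt j false) (D.pt j true)

/-- The interior of the segment. -/
def openSeg (j : J) : Set ℂ := openSegment ℝ (D.pt j false) (D.pt j true)

/-- The midpoint of a segment. -/
def mid (j : J) : ℂ := AffineMap.lineMap (D.pt j false) (D.pt j true) (1 / 2 : ℝ)

/-- The direction in which a segment leaves one of its ends. -/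
def dir (d : J × Bool) : ℂ := D.pt d.1 (!d.2) - D.pt d.1 d.2

theorem pt_ne_pt_not (j : J) (s : Bool) : D.pt j s ≠ D.pt j (!s) := by
  cases s
  · exact D.pt_ne j
  · exact (D.pt_ne j).symm

theorem dir_ne_zero (d : J × Bool) : D.dir d ≠ 0 := sub_ne_zero.2 (D.pt_ne_pt_not _ _).symm

theorem seg_eq (j : J) (s : Bool) : D.seg j = segment ℝ (D.pt j s) (D.pt j (!s)) := by
  cases s
  · rfl
  · exact segment_symm _ _ _

theorem openSeg_eq (j : J) (s : Bool) :
    D.openSeg j = openSegment ℝ (D.pt j s) (D.pt j (!s)) := by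
  cases s
  · rfl
  · exact openSegment_symm _ _ _

theorem pt_mem_seg (j : J) (s : Bool) : D.pt j s ∈ D.seg j := by
  rw [D.seg_eq j s]; exact left_mem_segment _ _ _

theorem openSeg_subset_seg (j : J) : D.openSeg j ⊆ D.seg j := openSegment_subset_segment _ _ _

theorem notMem_seg {j k : J} {x : ℂ} (h : j ≠ k) (hx : x ∈ D.openSeg j) : x ∉ D.seg k :=
  D.notMem_segment j k x h hx

theorem mid_mem (j : J) : D.mid j ∈ D.openSeg j := by
  rw [openSeg, openSegment_eq_image_lineMap]
  exact ⟨1 / 2, by norm_num, rfl⟩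

theorem pt_add_mul_dir_mem_openSeg (d : J × Bool) {t : ℝ} (ht : t ∈ Set.Ioo (0 : ℝ) 1) :
    D.pt d.1 d.2 + t * D.dir d ∈ D.openSeg d.1 := by
  rw [D.openSeg_eq d.1 d.2, openSegment_eq_image_lineMap]
  refine ⟨t, ht, ?_⟩
  rw [AffineMap.lineMap_apply]
  simp [dir]
  ring

/-- An end of a segment that lies on another segment is an end of it. -/
theorem exists_pt_eq_of_pt_mem_seg {d : J × Bool} {k : J} (h : D.pt d.1 d.2 ∈ D.seg k) :
    ∃ s, D.pt k s = D.pt d.1 d.2 := by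
  rw [seg, ← insert_endpoints_openSegment] at h
  rcases h with h | h | h
  · exact ⟨false, h.symm⟩
  · exact ⟨true, h.symm⟩
  · by_cases hk : k = d.1
    · exact ⟨d.2, by rw [hk]⟩
    · exact (D.notMem_seg hk h (D.pt_mem_seg d.1 d.2)).elim

/-- The product of the roots of the segments in `Z`, each oriented away from its end `s`. -/
def root (Z : Finset J) (s : Bool) (p : ℂ) : ℂ :=
  ∏ j ∈ Z, halfRoot (D.pt j s) (D.pt j (!s)) p

/-- A continuous square root of the product over all ends of the segments in `Z`. It exists if
each point is an end of an even number of segments in `Z`. -/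
structure IsSqrt (Z : Finset J) (H : ℂ → ℂ) : Prop where
  continuous : Continuous H
  sq_eq : ∀ p, H p ^ 2 = ∏ j ∈ Z, (D.pt j false - p) * (D.pt j true - p)

variable {D} {Z : Finset J} {H : ℂ → ℂ}

theorem IsSqrt.root_sq (hH : D.IsSqrt Z H) {p : ℂ} (hp : ∀ j ∈ Z, ∀ s, p ≠ D.pt j s) (s : Bool) :
    D.root Z s p ^ 2 = H p ^ 2 := by
  rw [hH.sq_eq, root, ← Finset.prod_pow]
  refine Finset.prod_congr rfl fun j hj => ?_
  rw [halfRoot_sq (hp j hj _) (hp j hj _)]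
  cases s
  · rfl
  · exact mul_comm _ _

theorem IsSqrt.ne_zero (hH : D.IsSqrt Z H) {p : ℂ} (hp : ∀ j ∈ Z, ∀ s, p ≠ D.pt j s) :
    H p ≠ 0 := by
  rw [← pow_ne_zero_iff two_ne_zero, hH.sq_eq, Finset.prod_ne_zero_iff]
  exact fun j hj => mul_ne_zero (sub_ne_zero.2 (hp j hj _).symm) (sub_ne_zero.2 (hp j hj _).symm)

/-- The sign by which `D.root Z s` and `H` differ is constant along a curve that meets the
segments in `Z` only from the left. -/
theorem IsSqrt.root_eq_iff (hH : D.IsSqrt Z H) {s : Bool} {γ : ℝ → ℂ} {S : Set ℝ}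
    (hS : IsPreconnected S) (hγ : ContinuousOn γ S)
    (h : ∀ j ∈ Z, (∀ x ∈ S, γ x ∉ D.seg j) ∨
      ∀ x ∈ S, LeftOf (D.pt j s) (D.pt j (!s)) (γ x)) {x y : ℝ} (hx : x ∈ S) (hy : y ∈ S) :
    D.root Z s (γ x) = H (γ x) ↔ D.root Z s (γ y) = H (γ y) := by
  have hne : ∀ x ∈ S, ∀ j ∈ Z, ∀ t, γ x ≠ D.pt j t := by
    intro x hx j hj t ht
    rcases h j hj with h | h
    · exact h x hx (ht ▸ D.pt_mem_seg j t)
    · by_cases hst : t = s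
      · subst hst; exact (h x hx).1 ht
      · rw [Bool.eq_not.2 hst] at ht; exact (h x hx).2.1 ht
  have hroot : ContinuousOn (fun x => D.root Z s (γ x)) S := by
    refine continuousOn_finsetProd _ fun j hj => continuousOn_halfRoot_comp hγ ?_
    rw [← D.seg_eq j s]
    exact h j hj
  have hHne : ∀ {x}, x ∈ S → H (γ x) ≠ 0 := fun {x} hx => hH.ne_zero (hne x hx)
  rcases hS.eq_or_eq_neg_of_sq_eq hroot (hH.continuous.comp_continuousOn hγ)
    (fun x hx => hH.root_sq (hne x hx) s) hHne with h' | h'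
  · exact iff_of_true (h' hx) (h' hy)
  · have : ∀ x ∈ S, D.root Z s (γ x) ≠ H (γ x) := fun x hx heq =>
      hHne hx (self_eq_neg.1 (heq.symm.trans (h' hx)))
    exact iff_of_false (this x hx) (this y hy)

theorem IsSqrt.root_eq_iff_mid (hH : D.IsSqrt Z H) (s : Bool) {j : J} {p : ℂ}
    (hp : p ∈ D.openSeg j) : D.root Z s p = H p ↔ D.root Z s (D.mid j) = H (D.mid j) := by
  have hmem : ∀ t ∈ Set.Ioo (0 : ℝ) 1,
      AffineMap.lineMap (D.pt j false) (D.pt j true) t ∈ D.openSeg j := by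
    intro t ht
    rw [openSeg, openSegment_eq_image_lineMap]
    exact ⟨t, ht, rfl⟩
  rw [openSeg, openSegment_eq_image_lineMap] at hp
  obtain ⟨t, ht, rfl⟩ := hp
  refine hH.root_eq_iff (γ := fun t => AffineMap.lineMap (D.pt j false) (D.pt j true) t)
    isPreconnected_Ioo AffineMap.lineMap_continuous.continuousOn (fun k _ => ?_) ht
    (by norm_num : (1 / 2 : ℝ) ∈ Set.Ioo (0 : ℝ) 1)
  by_cases hk : j = k
  · subst hk
    refine Or.inr fun x hx => leftOf_of_mem_openSegment (D.pt_ne_pt_not j s) ?_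
    rw [← D.openSeg_eq]
    exact hmem x hx
  · exact Or.inl fun x hx => D.notMem_seg hk (hmem x hx)

theorem root_eq_root_of_notMem {p : ℂ} (hp : ∀ j, p ∉ D.seg j) (s t : Bool) :
    D.root Z s p = D.root Z t p := by
  refine Finset.prod_congr rfl fun j _ => ?_
  by_cases hst : s = t
  · rw [hst]
  · rw [Bool.eq_not.2 hst, Bool.not_not]
    refine halfRoot_swap_of_notMem_segment ?_
    rw [← D.seg_eq]
    exact hp j

variable (D Z H) in
/-- The colour of the region to the left of a segment, seen from one of its ends. The regions of
the complement of the segments in `Z` are coloured by the sign by which the two square roots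
`D.root Z _` and `H` differ. -/
def leftColor (d : J × Bool) : ZMod 2 :=
  open Classical in if D.root Z d.2 (D.mid d.1) = H (D.mid d.1) then 0 else 1

/-- The colours on the two sides of a segment differ exactly if the segment is in `Z`. -/
theorem IsSqrt.leftColor_add_leftColor_not [DecidableEq J] (hH : D.IsSqrt Z H) (j : J) (s : Bool) :
    leftColor D Z H (j, s) + leftColor D Z H (j, !s) = if j ∈ Z then 1 else 0 := by
  have hmid := D.mid_mem j
  have hother : ∀ k ≠ j, halfRoot (D.pt k (!s)) (D.pt k s) (D.mid j) =
      halfRoot (D.pt k s) (D.pt k (!s)) (D.mid j) := by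
    intro k hk
    refine halfRoot_swap_of_notMem_segment ?_
    rw [← D.seg_eq]
    exact D.notMem_seg hk.symm hmid
  have hself : halfRoot (D.pt j (!s)) (D.pt j s) (D.mid j) =
      -halfRoot (D.pt j s) (D.pt j (!s)) (D.mid j) := by
    refine halfRoot_swap_of_mem_openSegment (D.pt_ne_pt_not j s) ?_
    rw [← D.openSeg_eq]
    exact hmid
  have hne : ∀ k ∈ Z, ∀ t, D.mid j ≠ D.pt k t := by
    intro k _ t ht
    by_cases hk : j = k
    · subst hk
      rw [D.openSeg_eq j t, ht, left_mem_openSegment_iff] at hmid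
      exact D.pt_ne_pt_not j t hmid
    · exact D.notMem_seg hk hmid (ht ▸ D.pt_mem_seg k t)
  unfold leftColor
  by_cases hj : j ∈ Z
  · have hflip : D.root Z (!s) (D.mid j) = -D.root Z s (D.mid j) := by
      unfold root
      rw [← Finset.mul_prod_erase _ _ hj, ← Finset.mul_prod_erase _ _ hj, ← neg_mul]
      simp only [Bool.not_not]
      rw [hself]
      congr 1
      exact Finset.prod_congr rfl fun k hk => hother k (Finset.ne_of_mem_erase hk)
    have h0 := hH.ne_zero hne
    simp only [hflip, hj, if_true]
    rcases sq_eq_sq_iff_eq_or_eq_neg.1 (hH.root_sq hne s) with h | h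
    · rw [h, if_pos rfl, if_neg (fun h' => h0 (neg_eq_self.1 h')), zero_add]
    · rw [h, neg_neg, if_pos rfl, if_neg (fun h' => h0 (neg_eq_self.1 h')), add_zero]
  · have hkeep : D.root Z (!s) (D.mid j) = D.root Z s (D.mid j) := by
      unfold root
      simp only [Bool.not_not]
      exact Finset.prod_congr rfl fun k hk => hother k fun h => hj (h ▸ hk)
    simp only [hkeep, hj, if_false]
    exact CharTwo.add_self_eq_zero _

/-- A small circle around `v` meets only the segments that end in `v`, and does not reach their
other ends. -/
theorem exists_radius [Finite J] (D : SegmentDrawing J) (v : ℂ) : ∃ ρ : ℝ, 0 < ρ ∧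
    (∀ d : J × Bool, D.pt d.1 d.2 = v → ρ < ‖D.dir d‖) ∧
    ∀ k, v ∉ D.seg k → ∀ p, ‖p - v‖ = ρ → p ∉ D.seg k := by
  have h1 : ∀ᶠ ρ in nhdsWithin (0 : ℝ) (Set.Ioi 0), ∀ d : J × Bool, ρ < ‖D.dir d‖ := by
    rw [Filter.eventually_all]
    exact fun d => mem_nhdsWithin_of_mem_nhds
      (gt_mem_nhds (norm_pos_iff.2 (D.dir_ne_zero d)))
  have h2 : ∀ᶠ ρ in nhdsWithin (0 : ℝ) (Set.Ioi 0), ∀ k, v ∉ D.seg k →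
      ∀ p, ‖p - v‖ = ρ → p ∉ D.seg k := by
    rw [Filter.eventually_all]
    intro k
    by_cases hv : v ∈ D.seg k
    · exact Filter.Eventually.of_forall fun _ h => (h hv).elim
    · have hcl : IsClosed (D.seg k) := by
        rw [seg, segment_eq_image_lineMap]
        exact (isCompact_Icc.image AffineMap.lineMap_continuous).isClosed
      obtain ⟨ε, hε, hball⟩ := Metric.isOpen_iff.1 hcl.isOpen_compl v hv
      filter_upwards [mem_nhdsWithin_of_mem_nhds (gt_mem_nhds hε)] with ρ hρ _ p hp
      exact hball (by rw [Metric.mem_ball, dist_eq_norm, hp]; exact hρ)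
  obtain ⟨ρ, hρ, h1, h2⟩ := (eventually_mem_nhdsWithin.and (h1.and h2)).exists
  exact ⟨ρ, hρ, fun d _ => h1 d, h2⟩

theorem norm_mul_exp_arg (d : J × Bool) :
    (‖D.dir d‖ : ℂ) * exp ((D.dir d).arg * I) = D.dir d := norm_mul_exp_arg_mul_I _

theorem circle_mem_openSeg {d : J × Bool} {ρ φ : ℝ} (hρ : 0 < ρ) (hd : ρ < ‖D.dir d‖)
    {n : ℤ} (hφ : φ = (D.dir d).arg + n * (2 * Real.pi)) :
    D.pt d.1 d.2 + ρ * exp (φ * I) ∈ D.openSeg d.1 := by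
  have hd0 : (‖D.dir d‖ : ℂ) ≠ 0 := by
    exact_mod_cast (norm_pos_iff.2 (D.dir_ne_zero d)).ne'
  have hexp : exp (φ * I) = exp ((D.dir d).arg * I) := by
    rw [exp_eq_exp_iff_exists_int]
    exact ⟨n, by rw [hφ]; push_cast; ring⟩
  have := D.pt_add_mul_dir_mem_openSeg d (t := ρ / ‖D.dir d‖)
    ⟨by have := hρ.trans hd; positivity, (div_lt_one (hρ.trans hd)).2 hd⟩
  convert this using 2
  rw [hexp]
  nth_rw 3 [← norm_mul_exp_arg]
  push_cast
  field_simp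

/-- A segment met by a small circle around one of its ends is met in its direction. -/
theorem exists_arg_eq_of_circle_mem_seg {d : J × Bool} {ρ φ : ℝ} (hρ : 0 < ρ)
    (h : D.pt d.1 d.2 + ρ * exp (φ * I) ∈ D.seg d.1) :
    ∃ n : ℤ, φ = (D.dir d).arg + n * (2 * Real.pi) := by
  rw [D.seg_eq d.1 d.2, segment_eq_image_lineMap] at h
  obtain ⟨t, ht, h⟩ := h
  have h1 : (t : ℂ) * D.dir d = ρ * exp (φ * I) := by
    rw [AffineMap.lineMap_apply] at h
    simp only [vsub_eq_sub, real_smul, vadd_eq_add] at h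
    rw [dir]
    linear_combination h
  have h2 : t * ‖D.dir d‖ = ρ := by
    have := congrArg norm h1
    simpa [abs_of_nonneg ht.1, abs_of_pos hρ] using this
  rw [← norm_mul_exp_arg, ← mul_assoc, ← h2] at h1
  push_cast at h1
  have h3 : (t * ‖D.dir d‖ : ℂ) ≠ 0 := by
    have := hρ.ne'; rw [← h2] at this; exact_mod_cast this
  have h4 := mul_left_cancel₀ h3 h1
  obtain ⟨n, hn⟩ := exp_eq_exp_iff_exists_int.1 h4.symm
  refine ⟨n, ?_⟩
  have h5 : (φ : ℂ) * I = (((D.dir d).arg + n * (2 * Real.pi) : ℝ) : ℂ) * I := by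
    rw [hn]; push_cast; ring
  exact_mod_cast mul_right_cancel₀ I_ne_zero h5

theorem circle_ne_pt {d : J × Bool} {ρ φ : ℝ} (hρ : 0 < ρ) (hd : ρ < ‖D.dir d‖) (s : Bool) :
    D.pt d.1 d.2 + ρ * exp (φ * I) ≠ D.pt d.1 s := by
  have hnorm : ‖(ρ : ℂ) * exp (φ * I)‖ = ρ := by simp [abs_of_pos hρ]
  intro h
  rw [← eq_sub_iff_add_eq'] at h
  rw [h] at hnorm
  by_cases hs : s = d.2
  · rw [hs, sub_self, norm_zero] at hnorm
    exact hρ.ne hnorm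
  · rw [Bool.eq_not.2 hs] at hnorm
    exact hd.ne' hnorm

theorem im_dir_mul_conj (d : J × Bool) (ρ φ : ℝ) :
    (D.dir d * conj (ρ * exp (φ * I))).im =
      -(‖D.dir d‖ * ρ * Real.sin (φ - (D.dir d).arg)) := by
  have : D.dir d * conj (ρ * exp (φ * I)) =
      ((‖D.dir d‖ * ρ : ℝ) : ℂ) * exp (((D.dir d).arg - φ : ℝ) * I) := by
    rw [map_mul, conj_ofReal, ← exp_conj, map_mul, conj_I, conj_ofReal]
    nth_rw 1 [← norm_mul_exp_arg]
    push_cast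
    rw [sub_mul, sub_eq_add_neg, exp_add, mul_neg]
    ring
  rw [this, im_ofReal_mul, exp_ofReal_mul_I_im, ← neg_sub φ, Real.sin_neg, mul_neg]

theorem im_mul_conj_dir (d : J × Bool) (ρ φ : ℝ) :
    (ρ * exp (φ * I) * conj (D.dir d)).im =
      ‖D.dir d‖ * ρ * Real.sin (φ - (D.dir d).arg) := by
  rw [← neg_neg (_ * _ * _ : ℝ), ← im_dir_mul_conj, ← conj_im, map_mul, conj_conj, mul_comm]

theorem leftOf_circle {d : J × Bool} {ρ φ : ℝ} (hρ : 0 < ρ) (hd : ρ < ‖D.dir d‖)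
    (h : 0 ≤ Real.sin (φ - (D.dir d).arg)) :
    LeftOf (D.pt d.1 d.2) (D.pt d.1 (!d.2)) (D.pt d.1 d.2 + ρ * exp (φ * I)) := by
  refine leftOf_of_im_nonneg (circle_ne_pt hρ hd _) (circle_ne_pt hρ hd _) ?_
  have : (D.pt d.1 (!d.2) - (D.pt d.1 d.2 + ρ * exp (φ * I))) *
      conj (D.pt d.1 d.2 - (D.pt d.1 d.2 + ρ * exp (φ * I))) =
      -(D.dir d * conj (ρ * exp (φ * I))) + normSq (ρ * exp (φ * I)) := by
    rw [normSq_eq_conj_mul_self, dir, sub_add_cancel_left, map_neg]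
    ring
  rw [this, add_im, neg_im, im_dir_mul_conj, ofReal_im, neg_neg, add_zero]
  have := norm_nonneg (D.dir d)
  positivity

theorem leftOf_circle_not {d : J × Bool} {ρ φ : ℝ} (hρ : 0 < ρ) (hd : ρ < ‖D.dir d‖)
    (h : Real.sin (φ - (D.dir d).arg) ≤ 0) :
    LeftOf (D.pt d.1 (!d.2)) (D.pt d.1 d.2) (D.pt d.1 d.2 + ρ * exp (φ * I)) := by
  refine leftOf_of_im_nonneg (circle_ne_pt hρ hd _) (circle_ne_pt hρ hd _) ?_
  have : (D.pt d.1 d.2 - (D.pt d.1 d.2 + ρ * exp (φ * I))) *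
      conj (D.pt d.1 (!d.2) - (D.pt d.1 d.2 + ρ * exp (φ * I))) =
      -(ρ * exp (φ * I) * conj (D.dir d)) + normSq (ρ * exp (φ * I)) := by
    rw [normSq_eq_conj_mul_self, sub_add_cancel_left,
      show D.pt d.1 (!d.2) - (D.pt d.1 d.2 + ρ * exp (φ * I)) = D.dir d - ρ * exp (φ * I) by
        rw [dir]; ring, map_sub]
    ring
  rw [this, add_im, neg_im, im_mul_conj_dir, ofReal_im, add_zero, ← mul_neg]
  have := norm_nonneg (D.dir d)
  have : 0 ≤ -Real.sin (φ - (D.dir d).arg) := by linarith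
  positivity

/-- Distinct segments leave a common end in distinct directions. -/
theorem eq_of_arg_eq {d d' : J × Bool} (hs : D.pt d.1 d.2 = D.pt d'.1 d'.2) {n : ℤ}
    (h : (D.dir d).arg = (D.dir d').arg + n * (2 * Real.pi)) : d = d' := by
  have h0 := norm_pos_iff.2 (D.dir_ne_zero d)
  have h0' := norm_pos_iff.2 (D.dir_ne_zero d')
  obtain ⟨ρ, hρ, hρ'⟩ := exists_between (lt_min h0 h0')
  have h1 := circle_mem_openSeg (n := 0) hρ (hρ'.trans_le (min_le_left _ _))
    (show (D.dir d).arg = (D.dir d).arg + (0 : ℤ) * (2 * Real.pi) by simp)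
  have h2 := circle_mem_openSeg hρ (hρ'.trans_le (min_le_right _ _)) h
  have hj : d.1 = d'.1 := by
    by_contra hne
    exact D.notMem_seg hne h1 (D.openSeg_subset_seg _ (hs ▸ h2))
  refine Prod.ext hj ?_
  by_contra hne
  rw [hj, Bool.eq_not.2 (Ne.symm hne)] at hs
  exact D.pt_ne_pt_not d'.1 d.2 hs

/-- The region between two consecutive segments at a point has one colour: the left side of the
first segment and the right side of the next one agree. If only one segment of the family ends at
the point, then `d' = d`, the sector is a full turn, and the two sides of that segment agree. -/
theorem IsSqrt.leftColor_eq [Finite J] (hH : D.IsSqrt Z H) {d d' : J × Bool}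
    (hs : D.pt d'.1 d'.2 = D.pt d.1 d.2)
    (hmin : ∀ d'' : J × Bool, D.pt d''.1 d''.2 = D.pt d.1 d.2 →
      ccwAngle (D.dir d) (D.dir d') ≤ ccwAngle (D.dir d) (D.dir d'')) :
    leftColor D Z H d = leftColor D Z H (d'.1, !d'.2) := by
  set v := D.pt d.1 d.2 with hv
  obtain ⟨ρ, hρ, hlen, hfar⟩ := D.exists_radius v
  set θ := (D.dir d).arg with hθ
  set α := ccwAngle (D.dir d) (D.dir d') with hα
  have hα0 : 0 < α := by
    have := (toIocMod_mem_Ioc Real.two_pi_pos 0 ((D.dir d').arg - θ)).1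
    exact this
  have hα1 : α ≤ 2 * Real.pi := by
    have := (toIocMod_mem_Ioc Real.two_pi_pos 0 ((D.dir d').arg - θ)).2
    exact this.trans_eq (zero_add _)
  obtain ⟨m, hm⟩ : ∃ m : ℤ, θ + α = (D.dir d').arg + m * (2 * Real.pi) := by
    refine ⟨-toIocDiv Real.two_pi_pos 0 ((D.dir d').arg - θ), ?_⟩
    rw [hα, ccwAngle, toIocMod, zsmul_eq_mul]
    push_cast
    ring
  set γ : ℝ → ℂ := fun φ => v + ρ * exp (φ * I) with hγ
  have hγc : Continuous γ := by fun_prop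
  have hnorm : ∀ φ, ‖γ φ - v‖ = ρ := fun φ => by simp [hγ, abs_of_pos hρ]
  -- the sector meets no segment but the two on its boundary
  have hsector : ∀ φ, θ ≤ φ → φ ≤ θ + α → ∀ k, γ φ ∈ D.seg k →
      (φ = θ ∧ d.1 = k) ∨ (φ = θ + α ∧ d'.1 = k) := by
    intro φ h1 h2 k hk
    have hvk : v ∈ D.seg k := by
      by_contra hvk
      exact hfar k hvk _ (hnorm φ) hk
    obtain ⟨s, hks⟩ := D.exists_pt_eq_of_pt_mem_seg hvk
    have hk' : D.pt (k, s).1 (k, s).2 + ρ * exp (φ * I) ∈ D.seg (k, s).1 := by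
      simp only [hks]; exact hk
    obtain ⟨n, hn⟩ := exists_arg_eq_of_circle_mem_seg hρ hk'
    rcases h1.eq_or_lt with h1 | h1
    · refine Or.inl ⟨h1.symm, ?_⟩
      exact congrArg Prod.fst (eq_of_arg_eq (D := D) (d := d) (d' := (k, s)) (n := n)
        hks.symm (by rw [← hn, ← h1]))
    · have hccw : ccwAngle (D.dir d) (D.dir (k, s)) = φ - θ := by
        rw [ccwAngle, toIocMod_eq_iff]
        refine ⟨⟨by linarith, by linarith⟩, -n, ?_⟩
        rw [hn, zsmul_eq_mul]
        push_cast
        ring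
      have hge := hmin (k, s) hks
      rw [hccw] at hge
      have hφ : φ = θ + α := le_antisymm h2 (by linarith)
      refine Or.inr ⟨hφ, ?_⟩
      refine congrArg Prod.fst (eq_of_arg_eq (D := D) (d := d') (d' := (k, s)) (n := n - m)
        (hs.trans hks.symm) ?_)
      push_cast
      linarith
  -- the bisector separates the two boundary rays even if they coincide after a full turn; there
  -- both orientations of the roots agree
  have hmid : ∀ k, γ (θ + α / 2) ∉ D.seg k := by
    intro k hk
    rcases hsector _ (by linarith) (by linarith) k hk with h | h
    · linarith [h.1]
    · linarith [h.1]
  -- the first half of the sector, with the first segment oriented away from `v`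
  have hfirst : D.root Z d.2 (γ θ) = H (γ θ) ↔
      D.root Z d.2 (γ (θ + α / 2)) = H (γ (θ + α / 2)) := by
    refine hH.root_eq_iff (S := Set.Icc θ (θ + α / 2)) isPreconnected_Icc hγc.continuousOn
      (fun k _ => ?_) ⟨le_rfl, by linarith⟩ ⟨by linarith, le_rfl⟩
    by_cases hk : d.1 = k
    · subst hk
      refine Or.inr fun φ hφ => leftOf_circle hρ (hlen d rfl) ?_
      exact Real.sin_nonneg_of_nonneg_of_le_pi (by linarith [hφ.1]) (by linarith [hφ.2])
    · refine Or.inl fun φ hφ hmem => ?_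
      rcases hsector φ hφ.1 (by linarith [hφ.2]) k hmem with h | h
      · exact hk h.2
      · linarith [h.1, hφ.2]
  -- the second half of the sector, with the last segment oriented towards `v`
  have hsecond : D.root Z (!d'.2) (γ (θ + α / 2)) = H (γ (θ + α / 2)) ↔
      D.root Z (!d'.2) (γ (θ + α)) = H (γ (θ + α)) := by
    refine hH.root_eq_iff (S := Set.Icc (θ + α / 2) (θ + α)) isPreconnected_Icc
      hγc.continuousOn (fun k _ => ?_) ⟨le_rfl, by linarith⟩ ⟨by linarith, le_rfl⟩
    by_cases hk : d'.1 = k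
    · subst hk
      refine Or.inr fun φ hφ => ?_
      rw [Bool.not_not]
      simp only [hγ]
      rw [← hs]
      refine leftOf_circle_not hρ (hlen d' hs) ?_
      rw [← Real.sin_sub_int_mul_two_pi _ m]
      refine Real.sin_nonpos_of_nonpos_of_neg_pi_le ?_ ?_
      · linarith [hφ.2]
      · linarith [hφ.1]
    · refine Or.inl fun φ hφ hmem => ?_
      rcases hsector φ (by linarith [hφ.1]) hφ.2 k hmem with h | h
      · linarith [h.1, hφ.1]
      · exact hk h.2
  have hstart : γ θ ∈ D.openSeg d.1 :=
    circle_mem_openSeg (n := 0) hρ (hlen d rfl) (by simp [hθ])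
  have hend : γ (θ + α) ∈ D.openSeg d'.1 := by
    have := circle_mem_openSeg hρ (hlen d' hs) hm
    rwa [hs] at this
  have key : D.root Z d.2 (D.mid d.1) = H (D.mid d.1) ↔
      D.root Z (!d'.2) (D.mid d'.1) = H (D.mid d'.1) := by
    rw [← hH.root_eq_iff_mid _ hstart, hfirst, root_eq_root_of_notMem hmid d.2 (!d'.2), hsecond,
      hH.root_eq_iff_mid _ hend]
  unfold leftColor
  simp only [key]

end SegmentDrawing
end

/-! ### Cycles of a plane graph bound -/

noncomputable section

theorem ccwAngle_le_two_pi (z w : ℂ) : ccwAngle z w ≤ 2 * Real.pi :=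
  (toIocMod_mem_Ioc Real.two_pi_pos 0 (w.arg - z.arg)).2.trans_eq (zero_add _)

namespace PlaneGraph

variable {V E : Type*} (Γ : PlaneGraph V E)

/-- The straight segments of all edges. -/
abbrev Segment : Type _ := Σ e : E, Fin ((Γ.path e).bends + 1)

theorem point_zero (x : Γ.Segment) :
    (Γ.path x.1).point x.2 0 = (Γ.path x.1).corner x.2.castSucc := by
  simp [PolygonalPath.point]

theorem point_one (x : Γ.Segment) :
    (Γ.path x.1).point x.2 1 = (Γ.path x.1).corner x.2.succ := by
  simp [PolygonalPath.point]

theorem corner_bend_ne_pos (e : E) (i : Fin (Γ.path e).bends) (v : V) :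
    (Γ.path e).corner i.succ.castSucc ≠ Γ.pos v := by
  rw [← Γ.point_zero ⟨e, i.succ⟩]
  exact Γ.interior_ne_pos e i.succ 0 (by simp) (fun h => Fin.succ_ne_zero _ h.1) v

theorem point_ne_corner (x : Γ.Segment) {t : ℝ} (ht : t ∈ Set.Ioo (0 : ℝ) 1) (e : E)
    (m : Fin ((Γ.path e).bends + 2)) :
    (Γ.path x.1).point x.2 t ≠ (Γ.path e).corner m := by
  have hpos := Γ.interior_ne_pos x.1 x.2 t ⟨ht.1.le, ht.2⟩ (fun h => ht.1.ne' h.2)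
  refine Fin.cases ?_ (fun m => ?_) m
  · rw [Γ.path_start]; exact hpos _
  · refine Fin.lastCases ?_ (fun i => ?_) m
    · rw [Fin.succ_last, Γ.path_end]; exact hpos _
    · rw [Fin.succ_castSucc, ← Γ.point_zero ⟨e, i.succ⟩]
      intro h
      have : (⟨x.1, x.2, t⟩ : Σ e : E, Fin ((Γ.path e).bends + 1) × ℝ) = ⟨e, i.succ, 0⟩ :=
        Γ.interior_injOn ⟨⟨ht.1.le, ht.2⟩, fun h => ht.1.ne' h.2⟩
          ⟨by simp, fun h => Fin.succ_ne_zero _ h.1⟩ h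
      have h0 := congrArg (fun y : Σ e : E, Fin ((Γ.path e).bends + 1) × ℝ => y.2.2) this
      exact ht.1.ne' h0

/-- The drawing of a plane graph, cut into straight segments. -/
def segmentDrawing : SegmentDrawing Γ.Segment where
  pt x s := (Γ.path x.1).corner (if s then x.2.succ else x.2.castSucc)
  pt_ne x := by simpa using Γ.corner_ne x.1 x.2
  notMem_segment := by
    rintro j k x hjk hx hk
    simp only [Bool.false_eq_true, if_false, if_true] at hx hk
    rw [openSegment_eq_image_lineMap] at hx
    rw [segment_eq_image_lineMap] at hk
    obtain ⟨t, ht, rfl⟩ := hx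
    obtain ⟨t', ht', h⟩ := hk
    replace h : (Γ.path j.1).point j.2 t = (Γ.path k.1).point k.2 t' := h.symm
    rcases ht'.1.eq_or_lt with h0 | h0
    · rw [← h0, Γ.point_zero k] at h
      exact Γ.point_ne_corner j ht _ _ h
    rcases ht'.2.eq_or_lt with h1 | h1
    · rw [h1, Γ.point_one k] at h
      exact Γ.point_ne_corner j ht _ _ h
    have : (⟨j.1, j.2, t⟩ : Σ e : E, Fin ((Γ.path e).bends + 1) × ℝ) = ⟨k.1, k.2, t'⟩ :=
      Γ.interior_injOn ⟨⟨ht.1.le, ht.2⟩, fun h => ht.1.ne' h.2⟩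
        ⟨⟨ht'.1, h1⟩, fun h => h0.ne' h.2⟩ h
    exact hjk (congrArg (fun y : Σ e : E, Fin ((Γ.path e).bends + 1) × ℝ =>
      (⟨y.1, y.2.1⟩ : Γ.Segment)) this)

/-- The first segment of a half-edge, seen from the source of the half-edge. -/
def firstSegment (d : Γ.Dart) : Γ.Segment × Bool := (⟨d.1, if d.2 then Fin.last _ else 0⟩, d.2)

theorem pt_firstSegment (d : Γ.Dart) :
    Γ.segmentDrawing.pt (Γ.firstSegment d).1 (Γ.firstSegment d).2 = Γ.pos (Γ.source d) := by
  obtain ⟨e, _ | _⟩ := d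
  · exact Γ.path_start e
  · exact Γ.path_end e

theorem dir_firstSegment (d : Γ.Dart) :
    Γ.segmentDrawing.dir (Γ.firstSegment d) = Γ.dir d := by
  obtain ⟨e, _ | _⟩ := d
  · rfl
  · rw [dir_true]; rfl

/-- The segment that follows a bend of an edge, seen from the bend. -/
def afterBend (e : E) (i : Fin (Γ.path e).bends) : Γ.Segment × Bool := (⟨e, i.succ⟩, false)

/-- The segment that precedes a bend of an edge, seen from the bend. -/
def beforeBend (e : E) (i : Fin (Γ.path e).bends) : Γ.Segment × Bool := (⟨e, i.castSucc⟩, true)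

/-- Each end of a segment is at the source of a half-edge or at a bend. -/
theorem segment_cases (y : Γ.Segment × Bool) : (∃ d, y = Γ.firstSegment d) ∨
    ∃ e i, y = Γ.afterBend e i ∨ y = Γ.beforeBend e i := by
  obtain ⟨⟨e, i⟩, _ | _⟩ := y
  · induction i using Fin.cases with
    | zero => exact Or.inl ⟨(e, false), rfl⟩
    | succ i => exact Or.inr ⟨e, i, Or.inl rfl⟩
  · induction i using Fin.lastCases with
    | last => exact Or.inl ⟨(e, true), rfl⟩
    | cast i => exact Or.inr ⟨e, i, Or.inr rfl⟩

theorem exists_firstSegment_eq {y : Γ.Segment × Bool} {v : V}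
    (h : Γ.segmentDrawing.pt y.1 y.2 = Γ.pos v) :
    ∃ d, y = Γ.firstSegment d ∧ Γ.source d = v := by
  rcases Γ.segment_cases y with ⟨d, rfl⟩ | ⟨e, i, rfl | rfl⟩
  · rw [pt_firstSegment] at h
    exact ⟨d, rfl, Γ.pos_injective h⟩
  · exact (Γ.corner_bend_ne_pos e i v h).elim
  · exact (Γ.corner_bend_ne_pos e i v h).elim

theorem corner_bend_injective {e e' : E} {i : Fin (Γ.path e).bends} {i' : Fin (Γ.path e').bends}
    (h : (Γ.path e).corner i.succ.castSucc = (Γ.path e').corner i'.succ.castSucc) :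
    (⟨e, i⟩ : Σ e : E, Fin (Γ.path e).bends) = ⟨e', i'⟩ := by
  rw [← Γ.point_zero ⟨e, i.succ⟩, ← Γ.point_zero ⟨e', i'.succ⟩] at h
  have : (⟨e, i.succ, 0⟩ : Σ e : E, Fin ((Γ.path e).bends + 1) × ℝ) = ⟨e', i'.succ, 0⟩ :=
    Γ.interior_injOn ⟨by simp, fun h => Fin.succ_ne_zero _ h.1⟩
      ⟨by simp, fun h => Fin.succ_ne_zero _ h.1⟩ h
  have he : e = e' := congrArg Sigma.fst this
  subst he
  simpa using this

theorem eq_afterBend_or_eq_beforeBend {y : Γ.Segment × Bool} {e : E} {i : Fin (Γ.path e).bends}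
    (h : Γ.segmentDrawing.pt y.1 y.2 = (Γ.path e).corner i.succ.castSucc) :
    y = Γ.afterBend e i ∨ y = Γ.beforeBend e i := by
  rcases Γ.segment_cases y with ⟨d, rfl⟩ | ⟨e', i', rfl | rfl⟩
  · rw [pt_firstSegment] at h
    exact (Γ.corner_bend_ne_pos e i _ h.symm).elim
  · obtain ⟨rfl, h⟩ := Sigma.mk.inj (Γ.corner_bend_injective h)
    rw [eq_of_heq h]
    exact Or.inl rfl
  · obtain ⟨rfl, h⟩ := Sigma.mk.inj (Γ.corner_bend_injective h)
    rw [eq_of_heq h]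
    exact Or.inr rfl

section Coloring

variable {Γ} {Z : Finset Γ.Segment} {H : ℂ → ℂ}

open SegmentDrawing

theorem leftColor_afterBend [Finite E] (hH : Γ.segmentDrawing.IsSqrt Z H) (e : E)
    (i : Fin (Γ.path e).bends) (s : Bool) :
    leftColor Γ.segmentDrawing Z H (⟨e, i.succ⟩, s) =
      leftColor Γ.segmentDrawing Z H (⟨e, i.castSucc⟩, s) := by
  cases s
  · refine hH.leftColor_eq (d := Γ.afterBend e i) (d' := Γ.beforeBend e i) rfl fun d'' h => ?_
    rcases Γ.eq_afterBend_or_eq_beforeBend (e := e) (i := i) h with rfl | rfl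
    · rw [ccwAngle_self]; exact ccwAngle_le_two_pi _ _
    · exact le_rfl
  · refine Eq.symm (hH.leftColor_eq (d := Γ.beforeBend e i) (d' := Γ.afterBend e i) rfl
      fun d'' h => ?_)
    rcases Γ.eq_afterBend_or_eq_beforeBend (e := e) (i := i) h with rfl | rfl
    · exact le_rfl
    · rw [ccwAngle_self]; exact ccwAngle_le_two_pi _ _

/-- The regions on one side of all segments of an edge have the same colour. -/
theorem leftColor_eq_zero [Finite E] (hH : Γ.segmentDrawing.IsSqrt Z H) (e : E)
    (i : Fin ((Γ.path e).bends + 1)) (s : Bool) :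
    leftColor Γ.segmentDrawing Z H (⟨e, i⟩, s) = leftColor Γ.segmentDrawing Z H (⟨e, 0⟩, s) := by
  induction i using Fin.induction with
  | zero => rfl
  | succ i ih => rw [leftColor_afterBend hH, ih]

theorem leftColor_rot [Finite E] (hH : Γ.segmentDrawing.IsSqrt Z H) (d : Γ.Dart) :
    leftColor Γ.segmentDrawing Z H (Γ.firstSegment d) =
      leftColor Γ.segmentDrawing Z H
        ((Γ.firstSegment (Γ.rot d)).1, !(Γ.firstSegment (Γ.rot d)).2) := by
  refine hH.leftColor_eq ?_ fun d'' h => ?_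
  · rw [pt_firstSegment, pt_firstSegment]
    exact congrArg _ (Γ.source_next d)
  · rw [pt_firstSegment] at h
    obtain ⟨d', rfl, h'⟩ := Γ.exists_firstSegment_eq h
    simp only [dir_firstSegment]
    exact Γ.ccwAngle_next_le d d' h'

/-- The bends of an edge are ends of two of its segments each, so that only the ends of the edge
remain up to squares. -/
theorem prod_corner_sub (e : E) (p : ℂ) :
    ∏ i, ((Γ.path e).corner (Fin.castSucc i) - p) * ((Γ.path e).corner i.succ - p) =
      (∏ i : Fin (Γ.path e).bends, ((Γ.path e).corner i.succ.castSucc - p)) ^ 2 *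
        ((Γ.pos (Γ.tail e) - p) * (Γ.pos (Γ.head e) - p)) := by
  rw [Finset.prod_mul_distrib, Fin.prod_univ_succ, Fin.prod_univ_castSucc, Fin.castSucc_zero,
    Γ.path_start, Fin.succ_last, Γ.path_end]
  simp only [Fin.succ_castSucc]
  ring

/-- The product over the ends of a mod-2 cycle has a continuous square root. -/
theorem exists_isSqrt [Fintype V] [Fintype E] (z : E → ZMod 2)
    (hz : ∀ v, (open Classical in ∑ d : Γ.Dart with Γ.source d = v, z d.1) = 0) :
    ∃ Z H, (∀ x, x ∈ Z ↔ z x.1 ≠ 0) ∧ Γ.segmentDrawing.IsSqrt Z H := by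
  classical
  set T : Finset E := Finset.univ.filter fun e => z e ≠ 0 with hT
  set n : V → ℕ := fun v => ((T ×ˢ Finset.univ).filter fun d : Γ.Dart => Γ.source d = v).card
    with hn
  have heven : ∀ v, Even (n v) := by
    intro v
    rw [← ZMod.natCast_eq_zero_iff_even, ← hz v]
    have h1 : ∀ x : ZMod 2, x ≠ 0 → x = 1 := by decide
    simp only [hn]
    rw [Finset.card_eq_sum_ones, Nat.cast_sum, Finset.sum_filter, Finset.sum_filter,
      ← Finset.sum_subset (Finset.subset_univ (T ×ˢ Finset.univ))]
    · refine Finset.sum_congr rfl fun d hd => ?_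
      have : z d.1 ≠ 0 := by simpa [hT] using hd
      rw [h1 _ this, Nat.cast_one]
    · intro d _ hd
      have : z d.1 = 0 := by simpa [hT] using hd
      simp [this]
  -- each vertex is the end of an even number of half-edges in the cycle
  refine ⟨T.sigma fun _ => Finset.univ, fun p => (∏ e ∈ T, ∏ i : Fin (Γ.path e).bends,
    ((Γ.path e).corner i.succ.castSucc - p)) * ∏ v, (Γ.pos v - p) ^ (n v / 2),
    fun x => by simp [hT], ?_, fun p => ?_⟩
  · fun_prop
  · rw [mul_pow, ← Finset.prod_pow, ← Finset.prod_pow, Finset.prod_sigma]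
    refine Eq.trans ?_ (Finset.prod_congr rfl fun e _ => (prod_corner_sub e p).symm)
    rw [Finset.prod_mul_distrib]
    congr 1
    have : ∀ e, (Γ.pos (Γ.tail e) - p) * (Γ.pos (Γ.head e) - p) =
        ∏ b : Bool, (Γ.pos (Γ.source (e, b)) - p) := by
      intro e
      rw [Fintype.prod_bool, mul_comm]
      rfl
    simp only [this]
    rw [← Finset.prod_product' T Finset.univ fun e b => Γ.pos (Γ.source (e, b)) - p,
      ← Finset.prod_fiberwise (T ×ˢ Finset.univ) Γ.source]
    refine Finset.prod_congr rfl fun v _ => ?_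
    rw [← pow_mul, Nat.div_mul_cancel (heven v).two_dvd, hn, ← Finset.prod_const]
    refine Finset.prod_congr rfl fun d hd => ?_
    rw [← (Finset.mem_filter.1 hd).2]

/-- A mod-2 cycle in a plane graph bounds: the corners (the corner to the left of a half-edge `d` is
named `d`, so that the one to the right of `d` is `Γ.rot.symm d`) can be coloured so that the
colour is constant along the boundary of each face, and differs on the two sides of an edge exactly
if the edge is in the cycle. -/
theorem exists_coloring [Fintype V] [Fintype E] (z : E → ZMod 2)
    (hz : ∀ v, (open Classical in ∑ d : Γ.Dart with Γ.source d = v, z d.1) = 0) :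
    ∃ g : Γ.Dart → ZMod 2, ∀ d, g (Γ.rot.symm (d.1, !d.2)) = g d ∧
      g d + g (Γ.rot.symm d) = z d.1 := by
  classical
  obtain ⟨Z, H, hZ, hH⟩ := exists_isSqrt z hz
  have hsymm : ∀ d, leftColor Γ.segmentDrawing Z H (Γ.firstSegment (Γ.rot.symm d)) =
      leftColor Γ.segmentDrawing Z H ((Γ.firstSegment d).1, !d.2) := by
    intro d
    rw [leftColor_rot hH, Equiv.apply_symm_apply]
    rfl
  refine ⟨fun d => leftColor Γ.segmentDrawing Z H (Γ.firstSegment d), fun d => ⟨?_, ?_⟩⟩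
  · dsimp only
    rw [hsymm]
    simp only [firstSegment, Bool.not_not]
    rw [leftColor_eq_zero hH, leftColor_eq_zero hH d.1 (if d.2 = true then _ else 0)]
  · have h1 : ∀ x : ZMod 2, x ≠ 0 → x = 1 := by decide
    dsimp only
    rw [hsymm]
    refine (hH.leftColor_add_leftColor_not _ _).trans ?_
    by_cases h : z d.1 = 0
    · simp [hZ, h]
    · simp [hZ, h1 _ h]

end Coloring

end PlaneGraph
end

/-! ### Rank–nullity on a subspace -/

noncomputable section

open Module

/-- Rank–nullity for the restriction of a linear map to a subspace. -/
theorem Submodule.finrank_map_add_finrank_inf_ker {K M N : Type*} [Field K] [AddCommGroup M]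
    [Module K M] [FiniteDimensional K M] [AddCommGroup N] [Module K N] (W : Submodule K M)
    (T : M →ₗ[K] N) :
    finrank K (W.map T) + finrank K (W ⊓ LinearMap.ker T : Submodule K M) = finrank K W := by
  rw [← LinearMap.finrank_range_add_finrank_ker (T.domRestrict W), LinearMap.range_domRestrict,
    LinearMap.ker_domRestrict]
  congr 1
  rw [← LinearMap.finrank_range_of_inj (f := W.subtype ∘ₗ ((LinearMap.ker T).comap W.subtype).subtype)
    (W.subtype_injective.comp (Submodule.subtype_injective _)), LinearMap.range_comp,
    Submodule.range_subtype, Submodule.map_comap_subtype]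

/-! ### The rotation at a vertex -/

theorem ccwAngle_eq_sub {x y w : ℂ} (h : ccwAngle x y < ccwAngle x w) :
    ccwAngle y w = ccwAngle x w - ccwAngle x y := by
  have b1 := Complex.neg_pi_lt_arg x
  have b2 := Complex.arg_le_pi x
  have b3 := Complex.neg_pi_lt_arg y
  have b4 := Complex.arg_le_pi y
  have b5 := Complex.neg_pi_lt_arg w
  have b6 := Complex.arg_le_pi w
  simp only [ccwAngle_eq] at h ⊢
  split_ifs at h ⊢ <;> linarith

theorem ccwAngle_pos (x y : ℂ) : 0 < ccwAngle x y :=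
  (toIocMod_mem_Ioc Real.two_pi_pos 0 (y.arg - x.arg)).1

theorem arg_eq_of_ccwAngle_eq {x y w : ℂ} (h : ccwAngle x y = ccwAngle x w) : y.arg = w.arg := by
  have b3 := Complex.neg_pi_lt_arg y
  have b4 := Complex.arg_le_pi y
  have b5 := Complex.neg_pi_lt_arg w
  have b6 := Complex.arg_le_pi w
  simp only [ccwAngle_eq] at h
  split_ifs at h <;> linarith

namespace PlaneGraph

variable {V E : Type*} (Γ : PlaneGraph V E)

/-- The other half of the same edge. -/
def flip (d : Γ.Dart) : Γ.Dart := (d.1, !d.2)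

@[simp]
theorem flip_flip (d : Γ.Dart) : Γ.flip (Γ.flip d) = d := by simp [flip]

theorem eq_or_eq_flip {a b : Γ.Dart} (h : a.1 = b.1) : b = a ∨ b = Γ.flip a := by
  by_cases h' : b.2 = a.2
  · exact Or.inl (Prod.ext h.symm h')
  · exact Or.inr (Prod.ext h.symm (Bool.eq_not.2 h'))

section Rotation

variable [Finite E]

theorem source_rot (d : Γ.Dart) : Γ.source (Γ.rot d) = Γ.source d := Γ.source_next d

theorem source_rot_symm (d : Γ.Dart) : Γ.source (Γ.rot.symm d) = Γ.source d := by
  rw [← Γ.source_rot, Equiv.apply_symm_apply]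

/-- The rotation permutes the half-edges at a vertex transitively. -/
theorem eq_of_rot_invariant {X : Type*} {h : Γ.Dart → X} (hrot : ∀ d, h (Γ.rot d) = h d)
    {d d' : Γ.Dart} (hs : Γ.source d = Γ.source d') : h d = h d' := by
  obtain ⟨x, ⟨hx, hxd⟩, hmin⟩ := Set.exists_min_image
    {x : Γ.Dart | Γ.source x = Γ.source d' ∧ h x = h d}
    (fun x => ccwAngle (Γ.dir x) (Γ.dir d')) (Set.toFinite _) ⟨d, hs, rfl⟩
  by_cases hne : Γ.rot x = d'
  · rw [← hne, hrot, hxd]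
  exfalso
  have hlt : ccwAngle (Γ.dir x) (Γ.dir (Γ.rot x)) < ccwAngle (Γ.dir x) (Γ.dir d') := by
    refine lt_of_le_of_ne (Γ.ccwAngle_next_le x d' hx.symm) fun heq => hne ?_
    exact Γ.eq_of_arg_eq ((Γ.source_rot x).trans hx) (arg_eq_of_ccwAngle_eq heq)
  have h1 := hmin (Γ.rot x) ⟨(Γ.source_rot x).trans hx, (hrot x).trans hxd⟩
  have h2 := ccwAngle_eq_sub hlt
  have h3 := ccwAngle_pos (Γ.dir x) (Γ.dir (Γ.rot x))
  linarith

theorem exists_comp_source_eq {h : Γ.Dart → ZMod 2} (hrot : ∀ d, h (Γ.rot.symm d) = h d) :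
    ∃ f : V → ZMod 2, ∀ d, f (Γ.source d) = h d := by
  classical
  refine ⟨fun v => if hv : ∃ d, Γ.source d = v then h hv.choose else 0, fun d => ?_⟩
  have hv : ∃ d', Γ.source d' = Γ.source d := ⟨d, rfl⟩
  simp only [hv, dif_pos]
  refine Γ.eq_of_rot_invariant (fun d => ?_) hv.choose_spec
  rw [← hrot, Equiv.symm_apply_apply]

end Rotation

/-! ### The mod-2 Laplacian -/

/-- Around a vertex, each corner lies next to two half-edges. -/
theorem sum_add_rot_symm [Fintype E] [DecidableEq V] (g : Γ.Dart → ZMod 2) (v : V) :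
    ∑ d : Γ.Dart with Γ.source d = v, (g d + g (Γ.rot.symm d)) = 0 := by
  rw [Finset.sum_add_distrib]
  have : ∑ d : Γ.Dart with Γ.source d = v, g (Γ.rot.symm d) =
      ∑ d : Γ.Dart with Γ.source d = v, g d := by
    refine Finset.sum_equiv Γ.rot.symm (fun d => ?_) fun _ _ => rfl
    simp [source_rot_symm]
  rw [this]
  exact CharTwo.add_self_eq_zero _

section Laplacian

variable [DecidableEq V] [Fintype E]

theorem mod2Laplacian_apply (v w : V) : Γ.mod2Laplacian v w =
    ∑ d : Γ.Dart with Γ.source d = v,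
      ((if v = w then 1 else 0) + if Γ.source (Γ.flip d) = w then 1 else 0) := by
  have hsum : ∑ d : Γ.Dart with Γ.source d = v,
      (if Γ.source (Γ.flip d) = w then (1 : ZMod 2) else 0) =
      ∑ e : E, ((if Γ.head e = v ∧ Γ.tail e = w then 1 else 0) +
        if Γ.tail e = v ∧ Γ.head e = w then 1 else 0) := by
    rw [Finset.sum_filter, Fintype.sum_prod_type]
    refine Finset.sum_congr rfl fun e _ => ?_
    rw [Fintype.sum_bool]
    simp only [source, flip, ite_and]
    simp
  rw [Finset.sum_add_distrib, hsum, mod2Laplacian, Matrix.of_apply]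
  by_cases hvw : v = w
  · -- both ends of a loop are at the same vertex, so loops contribute `2 = 0` to the second sum
    subst hvw
    simp only [if_true, degree, Finset.sum_const, nsmul_eq_mul, mul_one, left_eq_add]
    refine Finset.sum_eq_zero fun e _ => ?_
    rw [if_congr and_comm rfl rfl]
    exact CharTwo.add_self_eq_zero _
  · simp only [if_neg hvw, Finset.sum_const_zero, zero_add, numEdges]
    rw [Finset.card_eq_sum_ones, Nat.cast_sum, Finset.sum_filter]
    refine Finset.sum_congr rfl fun e _ => ?_
    by_cases h1 : Γ.tail e = v ∧ Γ.head e = w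
    · have h2 : ¬ (Γ.head e = v ∧ Γ.tail e = w) := fun h2 => hvw (h1.1.symm.trans h2.2)
      rw [if_pos (Or.inl h1), if_neg h2, if_pos h1, Nat.cast_one, zero_add]
    · simp [h1, and_comm]

/-- The mod-2 Laplacian sums the differences along the half-edges at a vertex. -/
theorem mod2Laplacian_mulVec [Fintype V] (f : V → ZMod 2) (v : V) : Γ.mod2Laplacian.mulVec f v =
    ∑ d : Γ.Dart with Γ.source d = v, (f (Γ.source d) + f (Γ.source (Γ.flip d))) := by
  simp only [Matrix.mulVec, dotProduct, mod2Laplacian_apply, Finset.sum_mul]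
  rw [Finset.sum_comm]
  refine Finset.sum_congr rfl fun d hd => ?_
  rw [(Finset.mem_filter.1 hd).2]
  simp [add_mul, Finset.sum_add_distrib]

end Laplacian

/-! ### Dehn colourings and link components -/

section Link

variable [Finite E] (r : E → Bool)

/-- A strand at a crossing joins opposite quarters of an edge, which are those on the same side of
the two half-edges. A corner `a` ends on the left of the half-edge `a` and on the right of
`Γ.rot a`. -/
theorem joined_iff {a b : Γ.Dart} : (Γ.medial.resolve r).Joined a b ↔
    a.1 = b.1 ∨ (Γ.rot a).1 = (Γ.rot b).1 := by
  have hfalse : ∀ a : Γ.Dart, (Γ.medial.resolve r).place (a, false) = (a.1, quarter (a.2, true)) :=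
    fun _ => rfl
  have htrue : ∀ a : Γ.Dart, (Γ.medial.resolve r).place (a, true) =
      ((Γ.rot a).1, quarter ((Γ.rot a).2, false)) := fun _ => rfl
  have hodd : ∀ b s, decide ((quarter (b, s)).val % 2 = 1) = !s := by decide
  simp only [LinkDiagram.Joined, Bool.exists_bool, hfalse, htrue, LinkDiagram.isUpper, hodd]
  constructor
  · rintro ((h | h) | (h | h))
    · exact Or.inl h.1
    · have h2 := h.2
      rw [← h.1] at h2
      cases h3 : (Γ.medial.resolve r).oddOver a.1 <;> simp [h3] at h2
    · have h2 := h.2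
      rw [← h.1] at h2
      cases h3 : (Γ.medial.resolve r).oddOver (Γ.rot a).1 <;> simp [h3] at h2
    · exact Or.inr h.1
  · rintro (h | h)
    · exact Or.inl (Or.inl ⟨h, by rw [h]⟩)
    · exact Or.inr (Or.inr ⟨h, by rw [h]⟩)

/-- The functions on the corners that are constant on each component of the link. -/
theorem joined_invariant_iff (h : Γ.Dart → ZMod 2) :
    (∀ a b, (Γ.medial.resolve r).Joined a b → h a = h b) ↔
      ∀ d, h (Γ.flip d) = h d ∧ h (Γ.rot.symm (Γ.flip d)) = h (Γ.rot.symm d) := by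
  simp only [joined_iff]
  constructor
  · exact fun H d => ⟨H _ _ (Or.inl rfl), H _ _ (Or.inr (by simp [flip]))⟩
  · rintro H a b (hab | hab)
    · rcases Γ.eq_or_eq_flip hab with rfl | rfl
      · rfl
      · exact (H a).1.symm
    · rcases Γ.eq_or_eq_flip hab with hb | hb
      · rw [Γ.rot.injective hb]
      · have := (H (Γ.rot a)).2
        rw [← hb, Equiv.symm_apply_apply, Equiv.symm_apply_apply] at this
        exact this.symm

/-- The space of mod-2 Dehn colourings of the regions of the medial graph: a colouring `f` of the
vertices of the graph and a colouring `g` of its faces, given as a colouring of the corners that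
is constant along the boundary of each face, such that the four colours around each edge have
sum `0`. -/
def dehnColorings : Submodule (ZMod 2) ((V → ZMod 2) × (Γ.Dart → ZMod 2)) where
  carrier := {c | ∀ d, c.2 (Γ.rot.symm (Γ.flip d)) = c.2 d ∧
    c.1 (Γ.source d) + c.1 (Γ.source (Γ.flip d)) = c.2 d + c.2 (Γ.rot.symm d)}
  zero_mem' := fun d => by simp
  add_mem' := by
    intro a b ha hb d
    refine ⟨by simp [(ha d).1, (hb d).1], ?_⟩
    simp only [Prod.fst_add, Prod.snd_add, Pi.add_apply]
    linear_combination (ha d).2 + (hb d).2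
  smul_mem' := by
    intro c a ha d
    refine ⟨by simp [(ha d).1], ?_⟩
    simp only [Prod.smul_fst, Prod.smul_snd, Pi.smul_apply, smul_eq_mul]
    linear_combination c * (ha d).2

theorem mem_dehnColorings {f : V → ZMod 2} {g : Γ.Dart → ZMod 2} :
    (f, g) ∈ Γ.dehnColorings ↔ ∀ d, g (Γ.rot.symm (Γ.flip d)) = g d ∧
      f (Γ.source d) + f (Γ.source (Γ.flip d)) = g d + g (Γ.rot.symm d) := Iff.rfl

/-- A corner carries the sum of the colours of the two regions that it separates, and the closed
curve around an isolated vertex the colour of that vertex. -/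
def curveColoring : (V → ZMod 2) × (Γ.Dart → ZMod 2) →ₗ[ZMod 2]
    (Γ.Dart → ZMod 2) × (Γ.Isolated → ZMod 2) where
  toFun c := (fun d => c.1 (Γ.source d) + c.2 d, fun v => c.1 v.1)
  map_add' a b := by
    ext x
    · simp; ring
    · simp
  map_smul' c a := by
    ext x
    · simp; ring
    · simp

/-- A function on the components of the link, as a function on the corners and the closed curves
without crossings. -/
def componentFunction : ((Γ.medial.resolve r).Component → ZMod 2) →ₗ[ZMod 2]
    (Γ.Dart → ZMod 2) × (Γ.Isolated → ZMod 2) where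
  toFun h := (fun d => h (Sum.inl (Quot.mk _ d)), fun v => h (Sum.inr v))
  map_add' _ _ := rfl
  map_smul' _ _ := rfl

theorem componentFunction_injective : Function.Injective (Γ.componentFunction r) := by
  intro h h' heq
  funext x
  rcases x with x | v
  · induction x using Quot.ind with
    | mk d => exact congrFun (congrArg Prod.fst heq) d
  · exact congrFun (congrArg Prod.snd heq) v

theorem mem_range_componentFunction {h : Γ.Dart → ZMod 2} {k : Γ.Isolated → ZMod 2} :
    (h, k) ∈ LinearMap.range (Γ.componentFunction r) ↔
      ∀ d, h (Γ.flip d) = h d ∧ h (Γ.rot.symm (Γ.flip d)) = h (Γ.rot.symm d) := by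
  rw [← Γ.joined_invariant_iff r]
  constructor
  · rintro ⟨c, hc⟩ a b hab
    obtain ⟨rfl, rfl⟩ := Prod.mk.inj hc
    exact congrArg (fun x => c (Sum.inl x)) (Quot.sound hab)
  · intro H
    exact ⟨Sum.elim (Quot.lift h H) k, rfl⟩

end Link

/-! ### Comparing the two projections of the Dehn colourings -/

section Count

/-- Every function on the components of the link comes from a Dehn colouring: its jumps across the
edges form a cycle, and a colouring `g` of the faces with these jumps leaves a function that is
constant around each vertex. -/
theorem map_curveColoring [Fintype V] [Fintype E] (r : E → Bool) :
    Γ.dehnColorings.map Γ.curveColoring = LinearMap.range (Γ.componentFunction r) := by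
  classical
  ext ⟨h, k⟩
  rw [mem_range_componentFunction]
  constructor
  · rintro ⟨⟨f, g⟩, hfg, heq⟩ d
    obtain ⟨rfl, rfl⟩ := Prod.mk.inj heq
    rw [SetLike.mem_coe, mem_dehnColorings] at hfg
    have h1 := hfg d
    have h2 := (hfg (Γ.flip d)).1
    rw [flip_flip] at h2
    dsimp only
    rw [source_rot_symm, source_rot_symm, ← h2, h1.1]
    constructor
    · exact (by decide : ∀ x y z w : ZMod 2, x + y = z + w → y + w = x + z) _ _ _ _ h1.2
    · exact (by decide : ∀ x y z w : ZMod 2, x + y = z + w → y + z = x + w) _ _ _ _ h1.2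
  · intro hh
    have hz : ∀ d : Γ.Dart, h (d.1, false) + h (Γ.rot.symm (d.1, false)) =
        h d + h (Γ.rot.symm d) := by
      rintro ⟨e, _ | _⟩
      · rfl
      · exact congrArg₂ (· + ·) (hh (e, true)).1 (hh (e, true)).2
    -- the two sides of each edge differ in `h` by a cycle
    obtain ⟨g, hg⟩ := Γ.exists_coloring (fun e => h (e, false) + h (Γ.rot.symm (e, false)))
      fun v => by simp only [hz]; exact Γ.sum_add_rot_symm h v
    simp only [hz] at hg
    obtain ⟨f, hf⟩ := Γ.exists_comp_source_eq (h := fun d => h d + g d) fun d =>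
      (by decide : ∀ x y z w : ZMod 2, x + y = z + w → w + y = z + x) _ _ _ _ (hg d).2
    set f' : V → ZMod 2 := fun v => if hv : ∀ d : Γ.Dart, Γ.source d ≠ v then k ⟨v, hv⟩ else f v
      with hf'
    have hsource : ∀ d, f' (Γ.source d) = h d + g d := by
      intro d
      rw [← hf, hf']
      exact dif_neg fun hv => hv d rfl
    refine ⟨(f', g), ?_, ?_⟩
    · rw [SetLike.mem_coe, mem_dehnColorings]
      refine fun d => ⟨(hg d).1, ?_⟩
      have h2 := (hg (Γ.flip d)).1
      have hflip : ((Γ.flip d).1, !(Γ.flip d).2) = d := Γ.flip_flip d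
      rw [hflip] at h2
      rw [hsource, hsource, (hh d).1, h2]
      exact (by decide : ∀ x y z : ZMod 2, x + y + (x + z) = y + z) _ _ _
    · refine Prod.ext (funext fun d => ?_) (funext fun v => dif_pos v.2)
      change f' (Γ.source d) + g d = h d
      rw [hsource, add_assoc, CharTwo.add_self_eq_zero, add_zero]

/-- A colouring of the vertices extends to the faces exactly if its differences along the edges
form a cycle, which is to say that it is in the kernel of the Laplacian. -/
theorem map_fst_dehnColorings [Fintype V] [DecidableEq V] [Fintype E] :
    Γ.dehnColorings.map (LinearMap.fst (ZMod 2) (V → ZMod 2) (Γ.Dart → ZMod 2)) =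
      LinearMap.ker Γ.mod2Laplacian.mulVecLin := by
  ext f
  rw [LinearMap.mem_ker, Matrix.mulVecLin_apply]
  constructor
  · rintro ⟨⟨f, g⟩, hfg, rfl⟩
    rw [SetLike.mem_coe, mem_dehnColorings] at hfg
    funext v
    rw [mod2Laplacian_mulVec]
    simp only [LinearMap.fst_apply, (hfg _).2]
    exact Γ.sum_add_rot_symm g v
  · intro hf
    have hz : ∀ d : Γ.Dart, f (Γ.source (d.1, false)) + f (Γ.source (Γ.flip (d.1, false))) =
        f (Γ.source d) + f (Γ.source (Γ.flip d)) := by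
      rintro ⟨e, _ | _⟩
      · rfl
      · exact add_comm _ _
    obtain ⟨g, hg⟩ := Γ.exists_coloring
      (fun e => f (Γ.source (e, false)) + f (Γ.source (Γ.flip (e, false)))) fun v => by
        simp only [hz]
        have := congrFun hf v
        rw [mod2Laplacian_mulVec, Pi.zero_apply] at this
        convert this
    simp only [hz] at hg
    exact ⟨(f, g), fun d => ⟨(hg d).1, (hg d).2.symm⟩, rfl⟩

/-- In both kernels, `g` ranges over the functions on the half-edges that are constant on the
connected components of the graph. -/
theorem map_snd_inf_ker [Finite E] :
    (Γ.dehnColorings ⊓ LinearMap.ker Γ.curveColoring).map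
        (LinearMap.snd (ZMod 2) (V → ZMod 2) (Γ.Dart → ZMod 2)) =
      (Γ.dehnColorings ⊓ LinearMap.ker (LinearMap.fst (ZMod 2) (V → ZMod 2)
        (Γ.Dart → ZMod 2))).map (LinearMap.snd (ZMod 2) (V → ZMod 2) (Γ.Dart → ZMod 2)) := by
  classical
  ext g
  constructor
  · rintro ⟨⟨f, g⟩, ⟨hfg, hker⟩, rfl⟩
    rw [SetLike.mem_coe, mem_dehnColorings] at hfg
    have hsource : ∀ d, f (Γ.source d) = g d := fun d =>
      CharTwo.add_eq_zero.1 (congrFun (congrArg Prod.fst hker) d)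
    refine ⟨(0, g), ⟨fun d => ⟨(hfg d).1, ?_⟩, rfl⟩, rfl⟩
    have : g (Γ.rot.symm d) = g d := by rw [← hsource, source_rot_symm, hsource]
    simp [this, CharTwo.add_self_eq_zero]
  · rintro ⟨⟨f, g⟩, ⟨hfg, hker⟩, rfl⟩
    rw [SetLike.mem_coe, mem_dehnColorings] at hfg
    obtain rfl : f = 0 := hker
    have hrot : ∀ d, g (Γ.rot.symm d) = g d := fun d =>
      (CharTwo.add_eq_zero.1 ((hfg d).2.symm.trans (by simp))).symm
    obtain ⟨f, hf⟩ := Γ.exists_comp_source_eq hrot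
    set f' : V → ZMod 2 := fun v => if ∀ d : Γ.Dart, Γ.source d ≠ v then 0 else f v with hf'
    have hsource : ∀ d, f' (Γ.source d) = g d := by
      intro d
      rw [← hf, hf']
      exact if_neg fun hv => hv d rfl
    refine ⟨(f', g), ⟨fun d => ⟨(hfg d).1, ?_⟩, ?_⟩, rfl⟩
    · have := (hfg d).1
      rw [hrot] at this
      simp [hsource, hrot, this]
    · refine Prod.ext (funext fun d => ?_) (funext fun v => if_pos v.2)
      change f' (Γ.source d) + g d = 0
      rw [hsource, CharTwo.add_self_eq_zero]

theorem inf_ker_inf_ker_snd_eq_bot [Finite E] :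
    Γ.dehnColorings ⊓ LinearMap.ker Γ.curveColoring ⊓
      LinearMap.ker (LinearMap.snd (ZMod 2) (V → ZMod 2) (Γ.Dart → ZMod 2)) = ⊥ := by
  rw [eq_bot_iff]
  rintro ⟨f, g⟩ ⟨⟨-, hker⟩, hg⟩
  obtain rfl : g = 0 := hg
  rw [Submodule.mem_bot, Prod.mk_eq_zero]
  refine ⟨funext fun v => ?_, rfl⟩
  by_cases hv : ∃ d : Γ.Dart, Γ.source d = v
  · obtain ⟨d, rfl⟩ := hv
    exact (add_zero _).symm.trans (congrFun (congrArg Prod.fst hker) d)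
  · exact congrFun (congrArg Prod.snd hker) ⟨v, fun d hd => hv ⟨d, hd⟩⟩

theorem finrank_inf_ker_eq [Finite V] [Finite E] :
    finrank (ZMod 2) (Γ.dehnColorings ⊓ LinearMap.ker Γ.curveColoring : Submodule _ _) =
      finrank (ZMod 2) (Γ.dehnColorings ⊓ LinearMap.ker (LinearMap.fst (ZMod 2) (V → ZMod 2)
        (Γ.Dart → ZMod 2)) : Submodule _ _) := by
  have hbot : Γ.dehnColorings ⊓ LinearMap.ker (LinearMap.fst (ZMod 2) (V → ZMod 2)
      (Γ.Dart → ZMod 2)) ⊓ LinearMap.ker (LinearMap.snd (ZMod 2) (V → ZMod 2)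
      (Γ.Dart → ZMod 2)) = ⊥ := by
    rw [eq_bot_iff]
    rintro ⟨f, g⟩ ⟨⟨-, hf⟩, hg⟩
    exact Prod.ext hf hg
  rw [← Submodule.finrank_map_add_finrank_inf_ker _
      (LinearMap.snd (ZMod 2) (V → ZMod 2) (Γ.Dart → ZMod 2)),
    ← Submodule.finrank_map_add_finrank_inf_ker
      (Γ.dehnColorings ⊓ LinearMap.ker (LinearMap.fst _ _ _))
      (LinearMap.snd (ZMod 2) (V → ZMod 2) (Γ.Dart → ZMod 2)),
    map_snd_inf_ker, inf_ker_inf_ker_snd_eq_bot, hbot]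

theorem numComponents_eq_finrank_range [Finite V] [Finite E] (r : E → Bool) :
    (Γ.medial.resolve r).numComponents =
      finrank (ZMod 2) (LinearMap.range (Γ.componentFunction r)) := by
  classical
  have : Finite (Γ.medial.resolve r).Component :=
    inferInstanceAs (Finite (Quot (Γ.medial.resolve r).Joined ⊕ Γ.Isolated))
  have := Fintype.ofFinite (Γ.medial.resolve r).Component
  rw [LinearMap.finrank_range_of_inj (Γ.componentFunction_injective r),
    Module.finrank_fintype_fun_eq_card, LinkDiagram.numComponents, Nat.card_eq_fintype_card]

end Count

end PlaneGraph
end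

theorem theorem1 {V E : Type*} [Fintype V] [DecidableEq V] [Fintype E]
    (Γ : PlaneGraph V E) (r : E → Bool) :
    (Γ.medial.resolve r).numComponents =
      Module.finrank (ZMod 2) (LinearMap.ker Γ.mod2Laplacian.mulVecLin) := by
  have h1 := Submodule.finrank_map_add_finrank_inf_ker Γ.dehnColorings Γ.curveColoring
  have h2 := Submodule.finrank_map_add_finrank_inf_ker Γ.dehnColorings
    (LinearMap.fst (ZMod 2) (V → ZMod 2) (Γ.Dart → ZMod 2))
  rw [Γ.map_curveColoring r, ← Γ.numComponents_eq_finrank_range r, Γ.finrank_inf_ker_eq] at h1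
  rw [Γ.map_fst_dehnColorings] at h2
  omega
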